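/- Let $k\ge 1$ and $\alpha>0$. A CSP kernel of arity $k$ is given by a finite set $\mathcal Y$ of constraint labels and, for each $u\in\{0,1\}^k$, a set $A(u)\subseteq\mathcal Y$ of authorized labels, where $|A(u)|\ge 1$ does not depend on $u$. For $u\in\{0,1\}^k$ let $\bar u$ be the vector obtained by flipping every component of $u$. Consider the kernels - $k$-SAT ($k\ge 1$): $\mathcal Y=\{0,1\}^k$ and $A(u)=\{0,1\}^k\setminus\{\bar u\}$; - $k$-NAE-SAT ($k\ge 2$): $\mathcal Y=\{0,1\}^k$ and $A(u)=\{0,1\}^k\setminus\{u,\bar u\}$; - $k$-XOR-SAT ($k\ge 2$ even): $\mathcal Y=\{0,1\}$ and $A(u)=\{u_1\oplus\cdots\oplus u_k\}$. For $n\ge k$, the random planted CSP with $n$ variables and density $\alpha$ is drawn as follows. The planted assignment $X$ is uniform on $\{0,1\}^n$. Independently of $X$, a random multi-edge hypergraph $G$ on $[n]$ is given by multiplicities $m_I$, one for each $k$-element subset $I\subseteq[n]$, which are independent Poisson variables of parameter $\alpha n/\binom nk$. Given $X$ and $G$, the labels $Y_I(1),\dots,Y_I(m_I)$, for all $I$,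 are independent, and $Y_I(i)$ is uniform on $A(X[I])$, where $x[I]\in\{0,1\}^k$ denotes the restriction of $x$ to $I$, listed in increasing order of the vertices. Let $$Z_G(Y)=\bigl|\{x\in\{0,1\}^n:\ Y_I(i)\in A(x[I])\ \text{for all } I \text{ and all } 1\le i\le m_I\}\bigr|$$ be the number of satisfying assignments. Then for each of the three kernels there is a constant $C$, depending only on $\alpha$, $k$ and the kernel (not on $n$), such that $\frac1n\log_2 Z_G(Y)\to C$ in probability as $n\to\infty$, that is, for every $\varepsilon>0$, $$\lim_{n\to\infty}\mathbb P\Bigl\{\Bigl|\tfrac1n\log_2 Z_G(Y)-C\Bigr|\ge\varepsilon\Bigr\}=0 .$$ -/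

import Mathlib

open MeasureTheory ProbabilityTheory Filter Topology
open scoped NNReal ENNReal

noncomputable section

namespace PlantedCSP

/-- A constraint satisfaction problem of arity `k` with binary variables, the alphabet `{0,1}`
being `ZMod 2`, and constraints labelled by the finite set `Y`. The set `auth u` consists of the
labels that are authorized when the variables of the constraint take the values `u`. All these
sets have the same (positive) number of elements. -/
structure CSP (k : ℕ) (Y : Type) where
  auth : (Fin k → ZMod 2) → Finset Y
  size : ℕ
  size_pos : 0 < size
  card_auth : ∀ u, (auth u).card = size

theorem CSP.auth_nonempty {k : ℕ} {Y : Type} (A : CSP k Y) (u : Fin k → ZMod 2) :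
    (A.auth u).Nonempty := by
  rw [← Finset.card_pos, A.card_auth]
  exact A.size_pos

/-- The kernel `Q(z | u) = 1(z ∈ A(u)) / |A(u)|`. -/
def CSP.kernel {k : ℕ} {Y : Type} (A : CSP k Y) (u : Fin k → ZMod 2) : PMF Y :=
  PMF.uniformOfFinset (A.auth u) (A.auth_nonempty u)

/-- The vector obtained from `u` by flipping every bit. -/
def flip {k : ℕ} (u : Fin k → ZMod 2) : Fin k → ZMod 2 := fun i => u i + 1

theorem flip_ne {k : ℕ} (hk : 1 ≤ k) (u : Fin k → ZMod 2) : u ≠ flip u := by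
  intro h
  have h0 := congrFun h ⟨0, hk⟩
  simp [flip] at h0

theorem card_vectors (k : ℕ) : Fintype.card (Fin k → ZMod 2) = 2 ^ k := by
  simp [ZMod.card]

/-- `k`-SAT: `A(u) = {0,1}^k ∖ {ū}`. -/
def kSAT (k : ℕ) (hk : 1 ≤ k) : CSP k (Fin k → ZMod 2) where
  auth u := Finset.univ \ {flip u}
  size := 2 ^ k - 1
  size_pos := by
    have : 2 ^ 1 ≤ 2 ^ k := Nat.pow_le_pow_right (by norm_num) hk
    omega
  card_auth u := by
    rw [Finset.card_sdiff_of_subset (Finset.subset_univ _), Finset.card_univ, card_vectors,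
      Finset.card_singleton]

/-- `k`-NAE-SAT: `A(u) = {0,1}^k ∖ {u, ū}`. -/
def kNAESAT (k : ℕ) (hk : 2 ≤ k) : CSP k (Fin k → ZMod 2) where
  auth u := Finset.univ \ {u, flip u}
  size := 2 ^ k - 2
  size_pos := by
    have : 2 ^ 2 ≤ 2 ^ k := Nat.pow_le_pow_right (by norm_num) hk
    omega
  card_auth u := by
    rw [Finset.card_sdiff_of_subset (Finset.subset_univ _), Finset.card_univ, card_vectors,
      Finset.card_pair (flip_ne (by omega) u)]

/-- `k`-XOR-SAT: `A(u) = {u₁ ⊕ ⋯ ⊕ u_k}`. -/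
def kXORSAT (k : ℕ) : CSP k (ZMod 2) where
  auth u := {∑ i, u i}
  size := 1
  size_pos := Nat.one_pos
  card_auth _ := Finset.card_singleton _

/-- The set `E_k([n])` of all hyperedges of order `k` on the vertex set `[n]`. -/
abbrev Edge (n k : ℕ) : Type := {I : Finset (Fin n) // I.card = k}

/-- The restriction `x[I]` of an assignment to the vertices of `I`, in increasing order. -/
def restrict {n k : ℕ} (x : Fin n → ZMod 2) (I : Edge n k) : Fin k → ZMod 2 :=
  fun i => x (I.1.orderEmbOfFin I.2 i)

/-- The multi-edge hypergraph ensemble `𝒫_k(α, n)`: the multiplicities `m_I` of the hyperedges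
`I` are independent Poisson variables of parameter `α n / (n choose k)`. -/
def hypergraphLaw (k : ℕ) (α : ℝ≥0) (n : ℕ) : PMF (Edge n k → ℕ) :=
  (Measure.pi fun _ : Edge n k => poissonMeasure (α * n / (n.choose k : ℝ≥0))).toPMF

/-- The edge variables of a hypergraph with multiplicities `m`: for each `I`, the labels
`y_I(1), …, y_I(m_I)`. -/
abbrev Obs {n k : ℕ} (Y : Type) (m : Edge n k → ℕ) : Type := (I : Edge n k) → Fin (m I) → Y

/-- The graphical channel `P_g(y | x) = ∏_I ∏_i Q(y_I(i) | x[I])`. -/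
def channel {n k : ℕ} {Y : Type} [Fintype Y] (Q : (Fin k → ZMod 2) → PMF Y)
    (m : Edge n k → ℕ) (x : Fin n → ZMod 2) : PMF (Obs Y m) :=
  PMF.ofFintype (fun y => ∏ I, ∏ i, Q (restrict x I) (y I i)) (by
    classical
    have h : ∀ I : Edge n k, ∑ w : Fin (m I) → Y, ∏ i, Q (restrict x I) (w i) = 1 := by
      intro I
      have hQ : ∑ z, Q (restrict x I) z = 1 := by
        rw [← tsum_fintype (L := .unconditional _)]
        exact (Q (restrict x I)).tsum_coe
      rw [← Fintype.prod_sum (fun (_ : Fin (m I)) z => Q (restrict x I) z)]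
      simp [hQ]
    rw [← Fintype.prod_sum
      (fun (I : Edge n k) (w : Fin (m I) → Y) => ∏ i, Q (restrict x I) (w i))]
    simp [h])

/-- The outcome of the planted experiment: the planted assignment `X`, the multi-edge hypergraph
`G`, given by its multiplicities, and the edge variables `Y`. -/
structure Sample (n k : ℕ) (Y : Type) where
  planted : Fin n → ZMod 2
  mult : Edge n k → ℕ
  obs : Obs Y mult

instance {n k : ℕ} {Y : Type} : MeasurableSpace (Sample n k Y) := ⊤

/-- The random planted CSP with `n` variables and constraint density `α`: `X` is uniform on
`{0,1}^n`, `G` is drawn from `𝒫_k(α, n)` independently of `X`, and `Y` is the output of `X`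
through the graphical channel with graph `G` and the kernel of the CSP. -/
def plantedLaw {k : ℕ} {Y : Type} [Fintype Y] (A : CSP k Y) (α : ℝ≥0) (n : ℕ) :
    PMF (Sample n k Y) :=
  (PMF.uniformOfFintype (Fin n → ZMod 2)).bind fun x =>
    (hypergraphLaw k α n).bind fun m =>
      (channel A.kernel m x).map fun y => ⟨x, m, y⟩

/-- The number `Z_G(Y)` of satisfying assignments, that is of the `x ∈ {0,1}^n` such that every
observed constraint is authorized by `x`. -/
def numSolutions {n k : ℕ} {Y : Type} (A : CSP k Y) (s : Sample n k Y) : ℕ :=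
  Set.ncard {x : Fin n → ZMod 2 | ∀ I i, s.obs I i ∈ A.auth (restrict x I)}

/-- The normalized logarithm of the number of solutions of the random planted CSP with density
`α` converges in probability, as `n → ∞`, to the constant `C`. -/
def LogCountTendstoInProb {k : ℕ} {Y : Type} [Fintype Y] (A : CSP k Y) (α : ℝ≥0) (C : ℝ) : Prop :=
  ∀ ε : ℝ, 0 < ε →
    Tendsto
      (fun n : ℕ => (plantedLaw A α n).toMeasure
        {s | ε ≤ |Real.logb 2 (numSolutions A s) / n - C|})
      atTop (𝓝 0)

end PlantedCSP

end

/-!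
The proof treats the random CSP as a chain of solution sets: each new constraint intersects the
current set `S` of solutions with the set `sat A e y` of the assignments that satisfy it. Averages
over the constraints act on functions of `S` by the operators `thin ρ K`. These preserve the order
and commute with each other, since intersections commute, and this replaces most probabilistic
arguments.

*Mean.* Given the observations, the planted assignment is uniform on the solutions
(`sum_planted_pow`), so the mean of `log Z` after `M` constraints is `2⁻ⁿ` times the value at the
full cube of the `M`-th power of an operator `annealed`, applied to `S ↦ |S| log |S|`.

Its growth rate is found by interpolation. In an auxiliary model edges are `k`-tuples of vertices
that may repeat. Confining the constraints to the two blocks of `[n₁ + n₂] = [n₁] ⊔ [n₂]` can only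
increase the entropy (`annealed_tuples_le`). Indeed the mean entropy after a constraint on `e` is,
up to constants, a power series with nonnegative coefficients in the posterior means `edgeMean`.
Expanded in independent replicas drawn from the posterior, its terms are products over the vertices
of `e`, whose average over `e` is the `k`-th power of an average over the vertices, and
`t ↦ t ^ k` is convex on the relevant range. This is where the three kernels enter, through
`CSP.HasReplicaExpansion`; for XOR the averages may be negative, and `k` has to be even. Because
the operators commute, the inequality for one constraint passes to all powers, and with a Poisson
number of constraints the two blocks become independent (`integral_poisson_thinning`). The Poisson
mean entropy is therefore subadditive in `n`, and Fekete's lemma gives the limit. Tuples with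
repetitions have a vanishing proportion, and a single constraint changes the mean by a bounded
amount (`edgeBound`), so the limit is the same for edges that are sets.

*Concentration.* For a fixed planted assignment the constraints are independent, and an
Efron–Stein inequality (`thin_pow_sq_le`) bounds the variance of `log Z` by `M` times the second
moment of the change caused by one constraint. Averaged over the planted assignment this moment is
bounded, because `t (log t)²` is bounded on `[0, 1]`. The mean does not depend on the planted
assignment because translations of the cube can be undone by relabelling the constraints. Thus
`log Z` has fluctuations of order `√n`, those of the Poisson number of constraints included.

*The model.* `plantedLaw_numSolutions` rewrites the product of Poisson laws as a Poisson number of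
independent uniform edges.
-/

noncomputable section

namespace PlantedCSP

/-! ### Thinning operators on functions of the solution set -/

/-- One step of a random thinning of a finite set: `thin ρ K F S` is the total of `F (S ∩ K c)`
over the constraints `c` with weights `ρ c`. For probability weights this is the transition
operator of the Markov chain that intersects the current set with a random `K c`. -/
def thin {C X : Type*} [Fintype C] [DecidableEq X] (ρ : C → ℝ) (K : C → Finset X) :
    Module.End ℝ (Finset X → ℝ) where
  toFun F S := ∑ c, ρ c * F (S ∩ K c)
  map_add' F G := by
    ext S
    simp [mul_add, Finset.sum_add_distrib]
  map_smul' a F := by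
    ext S
    simp [Finset.mul_sum, mul_left_comm]

section thin

variable {C C' X : Type*} [Fintype C] [Fintype C'] [DecidableEq X]

theorem thin_apply (ρ : C → ℝ) (K : C → Finset X) (F : Finset X → ℝ) (S : Finset X) :
    thin ρ K F S = ∑ c, ρ c * F (S ∩ K c) := rfl

theorem commute_thin (ρ : C → ℝ) (K : C → Finset X) (ρ' : C' → ℝ) (K' : C' → Finset X) :
    Commute (thin ρ K) (thin ρ' K') := by
  ext F S
  simp only [Module.End.mul_apply, thin_apply, Finset.mul_sum]
  rw [Finset.sum_comm]
  refine Finset.sum_congr rfl fun c _ => Finset.sum_congr rfl fun d _ => ?_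
  rw [Finset.inter_right_comm]
  ring

/-- A linear operator on functions that preserves the pointwise order. -/
def Positive {Z : Type*} (T : Module.End ℝ (Z → ℝ)) : Prop :=
  ∀ ⦃F G : Z → ℝ⦄, F ≤ G → T F ≤ T G

theorem positive_thin {ρ : C → ℝ} (hρ : ∀ c, 0 ≤ ρ c) (K : C → Finset X) :
    Positive (thin ρ K) := fun _ _ h _ =>
  Finset.sum_le_sum fun c _ => mul_le_mul_of_nonneg_left (h _) (hρ c)

namespace Positive

variable {Z : Type*} {T U : Module.End ℝ (Z → ℝ)}

theorem mul (hT : Positive T) (hU : Positive U) : Positive (T * U) :=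
  fun _ _ h => hT (hU h)

theorem pow (hT : Positive T) (M : ℕ) : Positive (T ^ M) := by
  induction M with
  | zero => exact fun _ _ h => h
  | succ M ih => rw [pow_succ]; exact ih.mul hT

theorem add (hT : Positive T) (hU : Positive U) : Positive (T + U) :=
  fun _ _ h => add_le_add (hT h) (hU h)

theorem smul (hT : Positive T) {a : ℝ} (ha : 0 ≤ a) : Positive (a • T) :=
  fun _ _ h S => mul_le_mul_of_nonneg_left (hT h S) ha

/-- If commuting positive operators satisfy `T g ≤ U g`, the same holds for all their powers. -/
theorem pow_le_pow (hT : Positive T) (hU : Positive U) (hc : Commute T U) {g : Z → ℝ}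
    (h : T g ≤ U g) (M : ℕ) : (T ^ M) g ≤ (U ^ M) g := by
  induction M with
  | zero => exact le_rfl
  | succ M ih =>
    calc (T ^ (M + 1)) g = (T ^ M) (T g) := by rw [pow_succ]; rfl
      _ ≤ (T ^ M) (U g) := hT.pow M h
      _ = U ((T ^ M) g) := by
        rw [← Module.End.mul_apply, (hc.pow_left M).eq]; rfl
      _ ≤ U ((U ^ M) g) := hU ih
      _ = (U ^ (M + 1)) g := by rw [pow_succ']; rfl

/-- If commuting positive operators fix `c` and `T g`, `U g` differ by at most a multiple of
`c`, then the difference of the `M`-th powers is at most `M` times as large. -/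
theorem pow_le_pow_add (hT : Positive T) (hU : Positive U) (hc : Commute T U) {g c : Z → ℝ}
    (hTc : T c = c) (hUc : U c = c) {δ : ℝ} (h : T g ≤ U g + δ • c) (M : ℕ) :
    (T ^ M) g ≤ (U ^ M) g + (M * δ) • c := by
  have hTcM : ∀ M : ℕ, (T ^ M) c = c := by
    intro M
    induction M with
    | zero => rfl
    | succ M ih => rw [pow_succ, Module.End.mul_apply, hTc, ih]
  induction M with
  | zero => simp
  | succ M ih =>
    calc (T ^ (M + 1)) g = (T ^ M) (T g) := by rw [pow_succ]; rfl
      _ ≤ (T ^ M) (U g + δ • c) := hT.pow M h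
      _ = U ((T ^ M) g) + δ • c := by
        rw [map_add, map_smul, hTcM, ← Module.End.mul_apply, (hc.pow_left M).eq]; rfl
      _ ≤ U ((U ^ M) g + (M * δ) • c) + δ • c := add_le_add_left (hU ih) _
      _ = (U ^ (M + 1)) g + (((M + 1 : ℕ) : ℝ) * δ) • c := by
        rw [map_add, map_smul, hUc, pow_succ', Module.End.mul_apply, Nat.cast_succ, add_mul,
          one_mul, add_smul, add_assoc]

end Positive

theorem thin_pow_apply (ρ : C → ℝ) (K : C → Finset X) (F : Finset X → ℝ) (M : ℕ)
    (S : Finset X) :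
    (thin ρ K ^ M) F S =
      ∑ c : Fin M → C, (∏ j, ρ (c j)) * F (S.filter fun x => ∀ j, x ∈ K (c j)) := by
  induction M generalizing S with
  | zero => simp
  | succ M ih =>
    rw [pow_succ', Module.End.mul_apply, thin_apply,
      ← (Fin.consEquiv fun _ : Fin (M + 1) => C).sum_comp, Fintype.sum_prod_type]
    refine Finset.sum_congr rfl fun c _ => ?_
    rw [ih, Finset.mul_sum]
    refine Finset.sum_congr rfl fun d _ => ?_
    simp only [Fin.consEquiv_apply, Fin.prod_univ_succ, Fin.cons_zero, Fin.cons_succ,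
      Fin.forall_fin_succ, mul_assoc]
    congr 3
    ext x
    simp only [Finset.mem_filter, Finset.mem_inter, and_assoc]

/-- The conditional second moment of the increment of `F` in one step of the thinning chain. -/
def incrementSq (ρ : C → ℝ) (K : C → Finset X) (F : Finset X → ℝ) (S : Finset X) : ℝ :=
  ∑ c, ρ c * (F (S ∩ K c) - F S) ^ 2

theorem sq_sum_le_sum_sq {ρ : C → ℝ} (hρ : ∀ c, 0 ≤ ρ c) (h1 : ∑ c, ρ c = 1) (f : C → ℝ) :
    (∑ c, ρ c * f c) ^ 2 ≤ ∑ c, ρ c * f c ^ 2 := by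
  simpa using (even_two.convexOn_pow (𝕜 := ℝ)).map_sum_le (t := Finset.univ) (w := ρ) (p := f)
    (fun c _ => hρ c) h1 (fun _ _ => Set.mem_univ _)

theorem thin_sq_le {ρ : C → ℝ} (h1 : ∑ c, ρ c = 1) (K : C → Finset X) (F : Finset X → ℝ) :
    thin ρ K (F ^ 2) ≤ (thin ρ K F) ^ 2 + incrementSq ρ K F := by
  intro S
  simp only [Pi.add_apply, Pi.pow_apply, thin_apply, incrementSq]
  have h : ∑ c, ρ c * (F (S ∩ K c) - F S) ^ 2 =
      ∑ c, ρ c * F (S ∩ K c) ^ 2 - 2 * F S * ∑ c, ρ c * F (S ∩ K c) + F S ^ 2 := by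
    rw [Finset.mul_sum, ← Finset.sum_sub_distrib, ← one_mul (F S ^ 2), ← h1, Finset.sum_mul,
      ← Finset.sum_add_distrib]
    exact Finset.sum_congr rfl fun c _ => by ring
  nlinarith [sq_nonneg (∑ c, ρ c * F (S ∩ K c) - F S)]

theorem incrementSq_thin_le {ρ : C → ℝ} (hρ : ∀ c, 0 ≤ ρ c) (h1 : ∑ c, ρ c = 1)
    (K : C → Finset X) (F : Finset X → ℝ) :
    incrementSq ρ K (thin ρ K F) ≤ thin ρ K (incrementSq ρ K F) := by
  intro S
  have h : ∀ c, (thin ρ K F (S ∩ K c) - thin ρ K F S) ^ 2 ≤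
      ∑ d, ρ d * (F (S ∩ K d ∩ K c) - F (S ∩ K d)) ^ 2 := by
    intro c
    refine le_trans (le_of_eq ?_) (sq_sum_le_sum_sq hρ h1 _)
    simp only [thin_apply, mul_sub, Finset.sum_sub_distrib, Finset.inter_right_comm]
  calc incrementSq ρ K (thin ρ K F) S
      ≤ ∑ c, ρ c * ∑ d, ρ d * (F (S ∩ K d ∩ K c) - F (S ∩ K d)) ^ 2 :=
        Finset.sum_le_sum fun c _ => mul_le_mul_of_nonneg_left (h c) (hρ c)
    _ = thin ρ K (incrementSq ρ K F) S := by
        simp only [thin_apply, incrementSq, Finset.mul_sum]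
        rw [Finset.sum_comm]
        exact Finset.sum_congr rfl fun d _ => Finset.sum_congr rfl fun c _ => by ring

/-- An Efron–Stein inequality: the variance of `F` after `M + 1` steps is at most `M + 1` times
the expected squared increment of `F` in the last step. As the intersections commute, any
constraint may be taken to be the last one. -/
theorem thin_pow_sq_le {ρ : C → ℝ} (hρ : ∀ c, 0 ≤ ρ c) (h1 : ∑ c, ρ c = 1) (K : C → Finset X)
    (F : Finset X → ℝ) (M : ℕ) :
    (thin ρ K ^ (M + 1)) (F ^ 2) ≤
      ((thin ρ K ^ (M + 1)) F) ^ 2 + ((M : ℝ) + 1) • (thin ρ K ^ M) (incrementSq ρ K F) := by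
  have hpos := positive_thin hρ K
  have hinc : ∀ M : ℕ, incrementSq ρ K ((thin ρ K ^ M) F) ≤ (thin ρ K ^ M) (incrementSq ρ K F) := by
    intro M
    induction M with
    | zero => exact le_rfl
    | succ M ih =>
      rw [pow_succ', Module.End.mul_apply, Module.End.mul_apply]
      exact (incrementSq_thin_le hρ h1 K _).trans (hpos ih)
  induction M with
  | zero => simpa using thin_sq_le h1 K F
  | succ M ih =>
    calc (thin ρ K ^ (M + 1 + 1)) (F ^ 2) = thin ρ K ((thin ρ K ^ (M + 1)) (F ^ 2)) := by
          rw [pow_succ']; rfl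
      _ ≤ thin ρ K (((thin ρ K ^ (M + 1)) F) ^ 2) +
          ((M : ℝ) + 1) • (thin ρ K ^ (M + 1)) (incrementSq ρ K F) := by
        refine (hpos ih).trans (le_of_eq ?_)
        rw [map_add, map_smul, pow_succ' _ M]; rfl
      _ ≤ ((thin ρ K ((thin ρ K ^ (M + 1)) F)) ^ 2 +
            (thin ρ K ^ (M + 1)) (incrementSq ρ K F)) +
          ((M : ℝ) + 1) • (thin ρ K ^ (M + 1)) (incrementSq ρ K F) := by
        gcongr
        exact (thin_sq_le h1 K _).trans (by gcongr; exact hinc _)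
      _ = _ := by
        rw [pow_succ' _ (M + 1), Module.End.mul_apply, Nat.cast_succ]
        module

end thin

/-! ### Planted and annealed evolution of the solution set -/

section evolution

variable {k n : ℕ} {Y ι : Type} (A : CSP k Y)

open Classical in
/-- The assignments that satisfy a constraint with label `y` on the tuple of vertices `e`. -/
def sat (e : Fin k → Fin n) (y : Y) : Finset (Fin n → ZMod 2) :=
  Finset.univ.filter fun x => y ∈ A.auth (x ∘ e)

@[simp]
theorem mem_sat {e : Fin k → Fin n} {y : Y} {x : Fin n → ZMod 2} :
    x ∈ sat A e y ↔ y ∈ A.auth (x ∘ e) := by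
  simp [sat]

variable [Fintype ι] (emb : ι → Fin k → Fin n)

open Classical in
/-- The probability that a uniformly random edge of the family `emb`, labelled according to the
planted assignment `x`, is the `c.1`-th one and has the label `c.2`. -/
def plantedWeight (x : Fin n → ZMod 2) (c : ι × Y) : ℝ :=
  if c.2 ∈ A.auth (x ∘ emb c.1) then ((Fintype.card ι : ℝ) * A.size)⁻¹ else 0

theorem CSP.size_cast_pos : (0 : ℝ) < A.size := Nat.cast_pos.2 A.size_pos

theorem plantedWeight_nonneg (x : Fin n → ZMod 2) (c : ι × Y) :
    0 ≤ plantedWeight A emb x c := by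
  unfold plantedWeight
  split_ifs <;> positivity

variable [Fintype Y]

/-- The transition operator of the solution set when constraints on uniformly random edges of the
family `emb` are added, whose labels are drawn according to the planted assignment `x`. -/
def planted (x : Fin n → ZMod 2) : Module.End ℝ (Finset (Fin n → ZMod 2) → ℝ) :=
  thin (plantedWeight A emb x) fun c => sat A (emb c.1) c.2

/-- The sum of the planted transition operators over the planted assignments, seen through
`F ↦ (S ↦ ∑ x ∈ S, F x S)`: given the observations, the planted assignment is uniform on the set
of solutions. -/
def annealed : Module.End ℝ (Finset (Fin n → ZMod 2) → ℝ) :=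
  thin (fun _ : ι × Y => ((Fintype.card ι : ℝ) * A.size)⁻¹) fun c => sat A (emb c.1) c.2

theorem sum_plantedWeight [Nonempty ι] (x : Fin n → ZMod 2) :
    ∑ c, plantedWeight A emb x c = 1 := by
  classical
  have hs := A.size_cast_pos.ne'
  have hι : (Fintype.card ι : ℝ) ≠ 0 := Nat.cast_ne_zero.2 Fintype.card_ne_zero
  have h : ∀ e : ι, ∑ y, plantedWeight A emb x (e, y) = (Fintype.card ι : ℝ)⁻¹ := by
    intro e
    simp only [plantedWeight, Finset.sum_ite_mem, Finset.univ_inter, Finset.sum_const,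
      A.card_auth, nsmul_eq_mul]
    field_simp
  rw [Fintype.sum_prod_type]
  simp [h, hι]

theorem positive_planted (x : Fin n → ZMod 2) : Positive (planted A emb x) :=
  positive_thin (plantedWeight_nonneg A emb x) _

theorem positive_annealed : Positive (annealed A emb) :=
  positive_thin (fun _ => by positivity) _

theorem commute_annealed {κ : Type} [Fintype κ] (emb' : κ → Fin k → Fin n) :
    Commute (annealed A emb) (annealed A emb') :=
  commute_thin _ _ _ _

/-- Summed over the planted assignments in the current set, the planted chain becomes the annealed
one. This encodes that the posterior distribution is uniform on the solutions. -/
theorem sum_planted_pow (F : (Fin n → ZMod 2) → Finset (Fin n → ZMod 2) → ℝ) (M : ℕ)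
    (S : Finset (Fin n → ZMod 2)) :
    ∑ x ∈ S, (planted A emb x ^ M) (F x) S =
      (annealed A emb ^ M) (fun S => ∑ x ∈ S, F x S) S := by
  induction M generalizing F S with
  | zero => simp
  | succ M ih =>
    simp only [pow_succ, Module.End.mul_apply]
    rw [ih fun x => planted A emb x (F x)]
    refine congrFun (congrArg _ (funext fun S => ?_)) S
    simp only [planted, annealed, thin_apply, Finset.mul_sum]
    rw [Finset.sum_comm]
    refine Finset.sum_congr rfl fun c _ => ?_
    rw [← Finset.filter_mem_eq_inter, Finset.sum_filter]
    refine Finset.sum_congr rfl fun x _ => ?_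
    by_cases h : c.2 ∈ A.auth (x ∘ emb c.1)
    · rw [plantedWeight, if_pos h, if_pos ((mem_sat A).2 h)]
    · rw [plantedWeight, if_neg h, if_neg (mt (mem_sat A).1 h), zero_mul]

/-- The number of elements of a set of assignments, as a real number. -/
def vol (S : Finset (Fin n → ZMod 2)) : ℝ := S.card

/-- The entropy of the uniform distribution on `S`. -/
def logVol (S : Finset (Fin n → ZMod 2)) : ℝ := Real.log S.card

/-- The entropy of the uniform distribution on `S`, times the number of elements of `S`. -/
def volLogVol (S : Finset (Fin n → ZMod 2)) : ℝ := S.card * Real.log S.card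

theorem vol_nonneg : 0 ≤ vol (n := n) := fun S => Nat.cast_nonneg S.card

theorem annealed_vol [Nonempty ι] : annealed A emb vol = vol (n := n) := by
  ext S
  have h := sum_planted_pow A emb (fun _ _ => 1) 1 S
  simp only [pow_one, Finset.sum_const, nsmul_eq_mul, mul_one] at h
  refine h.symm.trans ?_
  simp [planted, thin_apply, sum_plantedWeight, vol]

/-- The mean value of the entropy `log Z` after `M` uniformly random constraints on edges of the
family `emb`. -/
def meanLog (M : ℕ) : ℝ := (2 ^ n)⁻¹ * (annealed A emb ^ M) volLogVol Finset.univ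

/-- `volLogVol` after the addition of a constraint on the edge `e`, averaged over the labels. -/
def edgeEntropy (S : Finset (Fin n → ZMod 2)) (e : Fin k → Fin n) : ℝ :=
  (A.size : ℝ)⁻¹ * ∑ y, volLogVol (S ∩ sat A e y)

theorem annealed_volLogVol (S : Finset (Fin n → ZMod 2)) :
    annealed A emb volLogVol S = (Fintype.card ι : ℝ)⁻¹ * ∑ i, edgeEntropy A S (emb i) := by
  simp only [annealed, thin_apply, Fintype.sum_prod_type, edgeEntropy, Finset.mul_sum, mul_inv,
    mul_assoc]

theorem sum_card_inter_sat (S : Finset (Fin n → ZMod 2)) (e : Fin k → Fin n) :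
    ∑ y, ((S ∩ sat A e y).card : ℝ) = A.size * S.card := by
  classical
  have h : ∀ y, ((S ∩ sat A e y).card : ℝ) = ∑ x ∈ S, if y ∈ A.auth (x ∘ e) then 1 else 0 := by
    intro y
    rw [← Finset.filter_mem_eq_inter, Finset.sum_boole]
    simp
  simp only [h]
  rw [Finset.sum_comm]
  simp [A.card_auth, mul_comm]

theorem mul_log_sub_sq_le {r s : ℕ} (hrs : r ≤ s) :
    (r : ℝ) * (Real.log r - Real.log s) ^ 2 ≤ s := by
  rcases Nat.eq_zero_or_pos r with rfl | hr
  · simp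
  have hr' : (0 : ℝ) < r := Nat.cast_pos.2 hr
  have hs' : (0 : ℝ) < s := hr'.trans_le (Nat.cast_le.2 hrs)
  have h0 : 0 ≤ Real.log s - Real.log r :=
    sub_nonneg.2 (Real.log_le_log hr' (Nat.cast_le.2 hrs))
  set v := Real.log s - Real.log r with hv
  have hexp : (s : ℝ) = r * Real.exp v := by
    rw [hv, Real.exp_sub, Real.exp_log hs', Real.exp_log hr']
    field_simp
  -- `v² ≤ exp v` follows from `v ≤ exp (v / 2)` by squaring.
  have h2 : v ≤ Real.exp (v / 2) := by
    nlinarith [Real.quadratic_le_exp_of_nonneg (x := v / 2) (by linarith), sq_nonneg (v - 2)]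
  have h3 : v ^ 2 ≤ Real.exp v := by
    calc v ^ 2 ≤ Real.exp (v / 2) ^ 2 := by gcongr
      _ = Real.exp v := by rw [← Real.exp_nat_mul]; congr 1; push_cast; ring
  rw [show (Real.log r - Real.log s) = -v by rw [hv]; ring, neg_sq, hexp]
  gcongr

theorem mul_log_sub_le {r s : ℕ} (hrs : r ≤ s) :
    (r : ℝ) * (Real.log s - Real.log r) ≤ s := by
  rcases Nat.eq_zero_or_pos r with rfl | hr
  · simp
  have hr' : (0 : ℝ) < r := Nat.cast_pos.2 hr
  have hs' : (0 : ℝ) < s := hr'.trans_le (Nat.cast_le.2 hrs)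
  rw [← Real.log_div hs'.ne' hr'.ne']
  calc (r : ℝ) * Real.log (s / r) ≤ r * (s / r) := by
        gcongr
        exact Real.log_le_self (by positivity)
    _ = s := by field_simp

/-- A bound, independent of the number of vertices, for the effect of a single constraint on the
entropy of the solutions. -/
def edgeBound : ℝ := Fintype.card Y / A.size

theorem edgeBound_nonneg : 0 ≤ edgeBound A := by
  unfold edgeBound
  positivity

theorem edgeEntropy_le (S : Finset (Fin n → ZMod 2)) (e : Fin k → Fin n) :
    edgeEntropy A S e ≤ volLogVol S := by
  have hs := A.size_cast_pos
  rw [edgeEntropy, inv_mul_le_iff₀ hs, volLogVol, ← mul_assoc, ← sum_card_inter_sat A S e,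
    Finset.sum_mul]
  refine Finset.sum_le_sum fun y _ => ?_
  rw [volLogVol]
  rcases Nat.eq_zero_or_pos (S ∩ sat A e y).card with h | h
  · simp [h]
  · gcongr
    exact Finset.inter_subset_left

theorem le_edgeEntropy (S : Finset (Fin n → ZMod 2)) (e : Fin k → Fin n) :
    volLogVol S - edgeBound A * vol S ≤ edgeEntropy A S e := by
  have hs := A.size_cast_pos
  have h : ∑ y : Y, (((S ∩ sat A e y).card : ℝ) * Real.log S.card - volLogVol (S ∩ sat A e y)) ≤
      ∑ y : Y, (S.card : ℝ) := by
    refine Finset.sum_le_sum fun y _ => ?_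
    rw [volLogVol, ← mul_sub]
    exact mul_log_sub_le (Finset.card_le_card Finset.inter_subset_left)
  rw [Finset.sum_sub_distrib, ← Finset.sum_mul, sum_card_inter_sat] at h
  simp only [Finset.sum_const, Finset.card_univ, nsmul_eq_mul] at h
  rw [edgeEntropy, le_inv_mul_iff₀ hs, edgeBound, volLogVol, vol]
  have h2 : (A.size : ℝ) * (Fintype.card Y / A.size * S.card) = Fintype.card Y * S.card := by
    field_simp
  linarith

theorem annealed_volLogVol_le [Nonempty ι] :
    annealed A emb volLogVol ≤ volLogVol (n := n) := by
  intro S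
  have hι : (0 : ℝ) < Fintype.card ι := Nat.cast_pos.2 Fintype.card_pos
  rw [annealed_volLogVol, inv_mul_le_iff₀ hι]
  exact (Finset.sum_le_sum fun i _ => edgeEntropy_le A S (emb i)).trans (by simp)

theorem le_annealed_volLogVol [Nonempty ι] :
    volLogVol (n := n) ≤ annealed A emb volLogVol + edgeBound A • vol := by
  intro S
  have hι : (0 : ℝ) < Fintype.card ι := Nat.cast_pos.2 Fintype.card_pos
  rw [Pi.add_apply, ← sub_le_iff_le_add, annealed_volLogVol, le_inv_mul_iff₀ hι]
  refine le_trans ?_ (Finset.sum_le_sum fun i _ => le_edgeEntropy A S (emb i))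
  simp [mul_sub]

theorem annealed_pow_vol [Nonempty ι] (M : ℕ) :
    (annealed A emb ^ M) vol = vol (n := n) := by
  induction M with
  | zero => rfl
  | succ M ih => rw [pow_succ, Module.End.mul_apply, annealed_vol, ih]

theorem vol_univ : vol (Finset.univ : Finset (Fin n → ZMod 2)) = 2 ^ n := by
  simp [vol, ZMod.card]

theorem meanLog_succ_le [Nonempty ι] (M : ℕ) : meanLog A emb (M + 1) ≤ meanLog A emb M := by
  unfold meanLog
  gcongr
  rw [pow_succ]
  exact (positive_annealed A emb).pow M (annealed_volLogVol_le A emb) _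

theorem meanLog_le_succ [Nonempty ι] (M : ℕ) :
    meanLog A emb M ≤ meanLog A emb (M + 1) + edgeBound A := by
  have h := (positive_annealed A emb).pow M (le_annealed_volLogVol A emb) Finset.univ
  rw [map_add, map_smul, annealed_pow_vol, Pi.add_apply, Pi.smul_apply, vol_univ,
    ← Module.End.mul_apply, ← pow_succ, smul_eq_mul] at h
  unfold meanLog
  rw [← sub_le_iff_le_add', ← mul_sub, inv_mul_le_iff₀ (by positivity)]
  linarith

/-- One constraint changes the mean entropy by a bounded amount. -/
theorem abs_meanLog_sub_le [Nonempty ι] (M N : ℕ) :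
    |meanLog A emb M - meanLog A emb N| ≤ edgeBound A * |(M : ℝ) - N| := by
  have hanti : Antitone (meanLog A emb) := antitone_nat_of_succ_le (meanLog_succ_le A emb)
  have hmono : Monotone fun M : ℕ => meanLog A emb M + edgeBound A * M := by
    refine monotone_nat_of_le_succ fun M => ?_
    have := meanLog_le_succ A emb M
    push_cast
    linarith
  wlog h : M ≤ N generalizing M N
  · rw [abs_sub_comm, abs_sub_comm (M : ℝ)]
    exact this N M (le_of_not_ge h)
  have h1 := hanti h
  have h2 := hmono h
  simp only at h2
  rw [abs_of_nonneg (by linarith), abs_sub_comm, abs_of_nonneg (sub_nonneg.2 (Nat.cast_le.2 h))]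
  linarith

/-- The squared change of the entropy caused by one constraint has a bounded mean under the uniform
distribution of the planted assignment on `S`. For a single `x ∈ S` it is not bounded. -/
theorem sum_incrementSq_le (S : Finset (Fin n → ZMod 2)) :
    ∑ x ∈ S, incrementSq (plantedWeight A emb x) (fun c => sat A (emb c.1) c.2) logVol S ≤
      edgeBound A * vol S := by
  have hs := A.size_cast_pos
  simp only [incrementSq]
  rw [Finset.sum_comm]
  have h : ∀ c : ι × Y, ∑ x ∈ S, plantedWeight A emb x c *
      (logVol (S ∩ sat A (emb c.1) c.2) - logVol S) ^ 2 ≤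
      ((Fintype.card ι : ℝ) * A.size)⁻¹ * vol S := by
    intro c
    have hc : ∑ x ∈ S, plantedWeight A emb x c =
        ((Fintype.card ι : ℝ) * A.size)⁻¹ * (S ∩ sat A (emb c.1) c.2).card := by
      classical
      rw [← Finset.filter_mem_eq_inter, Finset.natCast_card_filter, Finset.mul_sum]
      refine Finset.sum_congr rfl fun x _ => ?_
      by_cases h : c.2 ∈ A.auth (x ∘ emb c.1)
      · rw [plantedWeight, if_pos h, if_pos ((mem_sat A).2 h), mul_one]
      · rw [plantedWeight, if_neg h, if_neg (mt (mem_sat A).1 h), mul_zero]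
    rw [← Finset.sum_mul, hc, mul_assoc]
    gcongr
    exact mul_log_sub_sq_le (Finset.card_le_card Finset.inter_subset_left)
  refine (Finset.sum_le_sum fun c _ => h c).trans ?_
  rw [Finset.sum_const, Finset.card_univ, Fintype.card_prod, nsmul_eq_mul, ← mul_assoc, edgeBound]
  refine mul_le_mul_of_nonneg_right ?_ (vol_nonneg S)
  rcases isEmpty_or_nonempty ι with hι | hι
  · simp
    positivity
  · have : (Fintype.card ι : ℝ) ≠ 0 := Nat.cast_ne_zero.2 Fintype.card_ne_zero
    push_cast
    refine le_of_eq ?_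
    field_simp

/-- For every translation of the assignments there is a relabelling of the constraints under which
the kernel is invariant. -/
def CSP.TranslationInvariant : Prop :=
  ∀ v : Fin k → ZMod 2, ∃ σ : Y ≃ Y, ∀ u y, σ y ∈ A.auth (u + v) ↔ y ∈ A.auth u

/-- For every permutation of the vertices of an edge there is a relabelling of the constraints
under which the kernel is invariant. -/
def CSP.PermInvariant : Prop :=
  ∀ π : Equiv.Perm (Fin k), ∃ σ : Y ≃ Y, ∀ u y, σ y ∈ A.auth (u ∘ π) ↔ y ∈ A.auth u

variable {A}

theorem planted_pow_translate (hA : A.TranslationInvariant) (a x : Fin n → ZMod 2) (M : ℕ)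
    (F F' : Finset (Fin n → ZMod 2) → ℝ)
    (hF : ∀ S, F' (S.map (Equiv.addRight a).toEmbedding) = F S) (S : Finset (Fin n → ZMod 2)) :
    (planted A emb (x + a) ^ M) F' (S.map (Equiv.addRight a).toEmbedding) =
      (planted A emb x ^ M) F S := by
  induction M generalizing F F' S with
  | zero => exact hF S
  | succ M ih =>
    rw [pow_succ, pow_succ, Module.End.mul_apply, Module.End.mul_apply]
    refine ih _ _ (fun S => ?_) S
    simp only [planted, thin_apply, Fintype.sum_prod_type]
    refine Finset.sum_congr rfl fun i _ => ?_
    obtain ⟨σ, hσ⟩ := hA (a ∘ emb i)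
    rw [← σ.sum_comp]
    refine Finset.sum_congr rfl fun y _ => ?_
    have hw : plantedWeight A emb (x + a) (i, σ y) = plantedWeight A emb x (i, y) := by
      classical
      exact if_congr (hσ (x ∘ emb i) y) rfl rfl
    have hK : S.map (Equiv.addRight a).toEmbedding ∩ sat A (emb i) (σ y) =
        (S ∩ sat A (emb i) y).map (Equiv.addRight a).toEmbedding := by
      have : sat A (emb i) (σ y) = (sat A (emb i) y).map (Equiv.addRight a).toEmbedding := by
        ext z
        obtain ⟨z, rfl⟩ := (Equiv.addRight a).surjective z
        simp only [Finset.mem_map_equiv, Equiv.symm_apply_apply, mem_sat]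
        exact hσ _ _
      rw [this, Finset.map_inter]
    rw [hw, hK, hF]

/-- The entropy of the solutions has the same mean value for all planted assignments. -/
theorem planted_pow_logVol (hA : A.TranslationInvariant) (x : Fin n → ZMod 2) (M : ℕ) :
    (planted A emb x ^ M) logVol Finset.univ = meanLog A emb M := by
  have h : ∀ x', (planted A emb x' ^ M) logVol Finset.univ =
      (planted A emb x ^ M) logVol Finset.univ := by
    intro x'
    have := planted_pow_translate emb hA (x' - x) x M logVol logVol
      (fun S => by simp [logVol]) Finset.univ
    rwa [Finset.map_univ_equiv, add_sub_cancel] at this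
  have h2 := sum_planted_pow A emb (fun _ => logVol) M Finset.univ
  simp only [h, Finset.sum_const, Finset.card_univ, nsmul_eq_mul] at h2
  rw [meanLog]
  simp only [Fintype.card_pi_const, ZMod.card] at h2
  change _ = (annealed A emb ^ M) volLogVol Finset.univ at h2
  rw [← h2]
  push_cast
  field_simp

theorem planted_pow_one [Nonempty ι] (x : Fin n → ZMod 2) (M : ℕ) :
    (planted A emb x ^ M) 1 = 1 := by
  induction M with
  | zero => rfl
  | succ M ih =>
    rw [pow_succ, Module.End.mul_apply]
    convert ih using 2
    ext S
    simp [planted, thin_apply, sum_plantedWeight]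

/-- The entropy of the solutions after `M` constraints has a variance of order `M`. -/
theorem mean_sq_logVol_sub_le [Nonempty ι] (hA : A.TranslationInvariant) (M : ℕ) (c : ℝ) :
    (2 ^ n)⁻¹ * ∑ x, (planted A emb x ^ M) (fun S => (logVol S - c) ^ 2) Finset.univ ≤
      edgeBound A * M + (meanLog A emb M - c) ^ 2 := by
  have hcard : ∀ a : ℝ, (2 ^ n : ℝ)⁻¹ * ∑ _x : Fin n → ZMod 2, a = a := by
    intro a
    simp [ZMod.card]
  set F : Finset (Fin n → ZMod 2) → ℝ := logVol - c • 1 with hF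
  have hsq : (fun S => (logVol S - c) ^ 2) = F ^ 2 := by
    ext S
    simp [hF]
  have hmean : ∀ x, (planted A emb x ^ M) F Finset.univ = meanLog A emb M - c := by
    intro x
    rw [hF, map_sub, map_smul, planted_pow_one, Pi.sub_apply, planted_pow_logVol emb hA]
    simp
  rw [hsq]
  cases M with
  | zero =>
    have : ∀ x, (planted A emb x ^ 0) (F ^ 2) Finset.univ = (meanLog A emb 0 - c) ^ 2 := by
      intro x
      rw [← hmean x]
      rfl
    simp only [this, hcard]
    simp
  | succ M =>
    have hES : ∀ x, (planted A emb x ^ (M + 1)) (F ^ 2) Finset.univ ≤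
        (meanLog A emb (M + 1) - c) ^ 2 + ((M : ℝ) + 1) * (planted A emb x ^ M)
          (incrementSq (plantedWeight A emb x) (fun c => sat A (emb c.1) c.2) logVol)
          Finset.univ := by
      intro x
      have h := thin_pow_sq_le (plantedWeight_nonneg A emb x) (sum_plantedWeight A emb x)
        (fun c => sat A (emb c.1) c.2) F M Finset.univ
      have hinc : incrementSq (plantedWeight A emb x) (fun c => sat A (emb c.1) c.2) F =
          incrementSq (plantedWeight A emb x) (fun c => sat A (emb c.1) c.2) logVol := by
        ext S
        simp [incrementSq, hF]
      rw [hinc] at h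
      refine h.trans (le_of_eq ?_)
      rw [← hmean x]
      rfl
    have hsum : ∑ x, (planted A emb x ^ M)
        (incrementSq (plantedWeight A emb x) (fun c => sat A (emb c.1) c.2) logVol)
          Finset.univ ≤ edgeBound A * 2 ^ n := by
      rw [sum_planted_pow A emb (fun x =>
        incrementSq (plantedWeight A emb x) (fun c => sat A (emb c.1) c.2) logVol) M Finset.univ]
      refine ((positive_annealed A emb).pow M
        (G := edgeBound A • vol) (sum_incrementSq_le A emb) _).trans (le_of_eq ?_)
      rw [map_smul, annealed_pow_vol, Pi.smul_apply, vol_univ, smul_eq_mul]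
    calc (2 ^ n)⁻¹ * ∑ x, (planted A emb x ^ (M + 1)) (F ^ 2) Finset.univ
        ≤ (2 ^ n)⁻¹ * ∑ x, ((meanLog A emb (M + 1) - c) ^ 2 +
          ((M : ℝ) + 1) * (planted A emb x ^ M)
          (incrementSq (plantedWeight A emb x) (fun c => sat A (emb c.1) c.2) logVol)
          Finset.univ) := by
          gcongr with x
          exact hES x
      _ ≤ (meanLog A emb (M + 1) - c) ^ 2 +
          (2 ^ n)⁻¹ * (((M : ℝ) + 1) * (edgeBound A * 2 ^ n)) := by
          rw [Finset.sum_add_distrib, mul_add, hcard, ← Finset.mul_sum]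
          gcongr
      _ = _ := by
          push_cast
          field_simp
          ring

end evolution

/-! ### Superadditivity of the edge entropy -/

/-- The mean of a function of a uniformly random `k`-tuple of vertices. -/
def tupleMean {n k : ℕ} (Θ : (Fin k → Fin n) → ℝ) : ℝ := ((n : ℝ) ^ k)⁻¹ * ∑ e, Θ e

/-- The mean of `Θ` over all `k`-tuples minus the average of its means over the tuples inside the
two blocks of `[n₁ + n₂] = [n₁] ⊔ [n₂]`, scaled by the number of vertices. -/
def blockDefect {n₁ n₂ k : ℕ} (Θ : (Fin k → Fin (n₁ + n₂)) → ℝ) : ℝ :=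
  ((n₁ : ℝ) + n₂) * tupleMean Θ - (n₁ * tupleMean (fun e => Θ (Fin.castAdd n₂ ∘ e)) +
    n₂ * tupleMean (fun e => Θ (Fin.natAdd n₁ ∘ e)))

section blockDefect

variable {n₁ n₂ k : ℕ}

theorem tupleMean_sum {n : ℕ} {ι : Type*} (s : Finset ι) (Θ : ι → (Fin k → Fin n) → ℝ) :
    tupleMean (fun e => ∑ i ∈ s, Θ i e) = ∑ i ∈ s, tupleMean (Θ i) := by
  simp only [tupleMean, Finset.mul_sum]
  exact Finset.sum_comm

theorem tupleMean_mul {n : ℕ} (a : ℝ) (Θ : (Fin k → Fin n) → ℝ) :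
    tupleMean (fun e => a * Θ e) = a * tupleMean Θ := by
  simp only [tupleMean, Finset.mul_sum, mul_left_comm]

theorem tupleMean_add {n : ℕ} (Θ Θ' : (Fin k → Fin n) → ℝ) :
    tupleMean (fun e => Θ e + Θ' e) = tupleMean Θ + tupleMean Θ' := by
  simp only [tupleMean, Finset.sum_add_distrib, mul_add]

theorem tupleMean_const {n : ℕ} (hn : 0 < n) (a : ℝ) :
    tupleMean (fun _ : Fin k → Fin n => a) = a := by
  have : (n : ℝ) ≠ 0 := by positivity
  simp [tupleMean, this]

theorem blockDefect_sum {ι : Type*} (s : Finset ι) (Θ : ι → (Fin k → Fin (n₁ + n₂)) → ℝ) :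
    blockDefect (fun e => ∑ i ∈ s, Θ i e) = ∑ i ∈ s, blockDefect (Θ i) := by
  simp only [blockDefect, tupleMean_sum, Finset.mul_sum, Finset.sum_sub_distrib,
    Finset.sum_add_distrib]

theorem blockDefect_mul (a : ℝ) (Θ : (Fin k → Fin (n₁ + n₂)) → ℝ) :
    blockDefect (fun e => a * Θ e) = a * blockDefect Θ := by
  simp only [blockDefect, tupleMean_mul]
  ring

theorem blockDefect_const_add (hn₁ : 0 < n₁) (hn₂ : 0 < n₂) (a : ℝ)
    (Θ : (Fin k → Fin (n₁ + n₂)) → ℝ) :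
    blockDefect (fun e => a + Θ e) = blockDefect Θ := by
  simp only [blockDefect, tupleMean_add, tupleMean_const hn₁, tupleMean_const hn₂,
    tupleMean_const (add_pos hn₁ hn₂)]
  ring

theorem tendsto_blockDefect {α : Type*} {l : Filter α} {Θ : α → (Fin k → Fin (n₁ + n₂)) → ℝ}
    {Θ' : (Fin k → Fin (n₁ + n₂)) → ℝ} (h : ∀ e, Tendsto (fun a => Θ a e) l (𝓝 (Θ' e))) :
    Tendsto (fun a => blockDefect (Θ a)) l (𝓝 (blockDefect Θ')) := by
  have hm : ∀ {n : ℕ} (f : (Fin k → Fin n) → Fin k → Fin (n₁ + n₂)),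
      Tendsto (fun a => tupleMean fun e => Θ a (f e)) l (𝓝 (tupleMean fun e => Θ' (f e))) :=
    fun f => (tendsto_finsetSum _ fun e _ => h (f e)).const_mul _
  exact ((hm id).const_mul _).sub (((hm _).const_mul _).add ((hm _).const_mul _))

theorem hasSum_blockDefect {Θ : ℕ → (Fin k → Fin (n₁ + n₂)) → ℝ}
    {Θ' : (Fin k → Fin (n₁ + n₂)) → ℝ} (h : ∀ e, HasSum (fun l => Θ l e) (Θ' e)) :
    HasSum (fun l => blockDefect (Θ l)) (blockDefect Θ') := by
  refine (tendsto_blockDefect (Θ := fun s e => ∑ l ∈ s, Θ l e) h).congr fun s => ?_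
  exact blockDefect_sum s Θ

/-- For product functions the superadditivity reduces to the convexity of the `k`-th power. -/
theorem blockDefect_prod_nonpos (hn₁ : 0 < n₁) (hn₂ : 0 < n₂) (G : Fin (n₁ + n₂) → ℝ)
    (hG : (∀ v, 0 ≤ G v) ∨ Even k) :
    blockDefect (fun e : Fin k → Fin (n₁ + n₂) => ∏ i, G (e i)) ≤ 0 := by
  have hm : ∀ {n : ℕ} (f : Fin n → Fin (n₁ + n₂)),
      tupleMean (fun e : Fin k → Fin n => ∏ i, G (f (e i))) = ((∑ v, G (f v)) / n) ^ k := by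
    intro n f
    rw [tupleMean, ← Fintype.sum_pow fun v => G (f v), div_pow, div_eq_inv_mul]
  have h0 := hm id
  have h1 := hm (Fin.castAdd n₂)
  have h2 := hm (Fin.natAdd n₁)
  simp only [id] at h0
  simp only [blockDefect, Function.comp_apply, h0, h1, h2, Fin.sum_univ_add]
  set S₁ := ∑ v, G (Fin.castAdd n₂ v) with hS₁
  set S₂ := ∑ v, G (Fin.natAdd n₁ v) with hS₂
  have p1 : (0 : ℝ) < n₁ := Nat.cast_pos.2 hn₁
  have p2 : (0 : ℝ) < n₂ := Nat.cast_pos.2 hn₂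
  have hconv : ((n₁ : ℝ) / (n₁ + n₂) * (S₁ / n₁) + n₂ / (n₁ + n₂) * (S₂ / n₂)) ^ k ≤
      (n₁ : ℝ) / (n₁ + n₂) * (S₁ / n₁) ^ k + n₂ / (n₁ + n₂) * (S₂ / n₂) ^ k := by
    have hsum : (n₁ : ℝ) / (n₁ + n₂) + n₂ / (n₁ + n₂) = 1 := by field_simp
    rcases hG with hG | hG
    · exact (convexOn_pow k).2
        (div_nonneg (Finset.sum_nonneg fun v _ => hG _) p1.le)
        (div_nonneg (Finset.sum_nonneg fun v _ => hG _) p2.le)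
        (by positivity) (by positivity) hsum
    · exact hG.convexOn_pow.2 (Set.mem_univ _) (Set.mem_univ _)
        (by positivity) (by positivity) hsum
  have he : ((n₁ : ℝ) / (n₁ + n₂) * (S₁ / n₁) + n₂ / (n₁ + n₂) * (S₂ / n₂)) =
      (S₁ + S₂) / (n₁ + n₂) := by field_simp
  rw [he] at hconv
  push_cast
  have := mul_le_mul_of_nonneg_left hconv (add_pos p1 p2).le
  have he2 : ((n₁ : ℝ) + n₂) * ((n₁ : ℝ) / (n₁ + n₂) * (S₁ / n₁) ^ k +
      n₂ / (n₁ + n₂) * (S₂ / n₂) ^ k) = n₁ * (S₁ / n₁) ^ k + n₂ * (S₂ / n₂) ^ k := by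
    field_simp
  linarith

end blockDefect

/-- The function `q + (1 - q) log (1 - q)`, whose power series has nonnegative coefficients. -/
def entropySeries (q : ℝ) : ℝ := q + (1 - q) * Real.log (1 - q)

theorem continuous_entropySeries : Continuous entropySeries :=
  continuous_id.add (Real.continuous_mul_log.comp (continuous_const.sub continuous_id))

theorem hasSum_entropySeries {q : ℝ} (hq : |q| < 1) :
    HasSum (fun l : ℕ => (((l : ℝ) + 1)⁻¹ - ((l : ℝ) + 2)⁻¹) * q ^ (l + 2)) (entropySeries q) := by
  have h := Real.hasSum_pow_div_log_of_abs_lt_one hq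
  have h1 := (hasSum_nat_add_iff' 1).2 h
  have h2 := (h.mul_left q).sub h1
  convert! h2 using 1
  · ext l
    push_cast
    ring
  · simp [entropySeries]
    ring

/-- A representation of the kernel of a CSP, up to the factor `κ`, as `1 - ψ y u`, in which the
products of the functions `ψ y` over several replicas of `u`, summed over the labels `y`, are
nonnegative combinations of products over the vertices of the edge. Moreover the factors are
nonnegative or there is an even number of them, so that convexity applies. -/
structure CSP.HasReplicaExpansion {k : ℕ} {Y : Type} [Fintype Y] (A : CSP k Y) (κ : ℝ)
    (ψ : Y → (Fin k → ZMod 2) → ℝ) : Prop where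
  pos : 0 < κ
  abs_le_one : ∀ y u, |ψ y u| ≤ 1
  auth_eq : ∀ y u, (Set.indicator (A.auth u : Set Y) 1 y : ℝ) = κ * (1 - ψ y u)
  expand : ∀ l : ℕ, ∃ (T : Type) (_ : Fintype T) (w : T → ℝ) (G : T → (Fin l → ZMod 2) → ℝ),
    (∀ τ, 0 ≤ w τ) ∧ ((∀ τ v, 0 ≤ G τ v) ∨ Even k) ∧
      ∀ U : Fin l → Fin k → ZMod 2,
        ∑ y, ∏ j, ψ y (U j) = ∑ τ, w τ * ∏ i, G τ fun j => U j i

section superadditive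

variable {k n n₁ n₂ : ℕ} {Y : Type} [Fintype Y] {A : CSP k Y} {κ : ℝ}
  {ψ : Y → (Fin k → ZMod 2) → ℝ}

/-- The mean of `ψ y` at the restriction to `e` of a uniformly random element of `S`. -/
def edgeMean (ψ : Y → (Fin k → ZMod 2) → ℝ) (S : Finset (Fin n → ZMod 2)) (y : Y)
    (e : Fin k → Fin n) : ℝ :=
  (S.card : ℝ)⁻¹ * ∑ x ∈ S, ψ y (x ∘ e)

theorem abs_edgeMean_le (hψ : A.HasReplicaExpansion κ ψ) (S : Finset (Fin n → ZMod 2)) (y : Y)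
    (e : Fin k → Fin n) : |edgeMean ψ S y e| ≤ 1 := by
  have h : |∑ x ∈ S, ψ y (x ∘ e)| ≤ S.card := by
    refine (Finset.abs_sum_le_sum_abs _ _).trans
      ((Finset.sum_le_sum fun x _ => hψ.abs_le_one y _).trans (by simp))
  rw [edgeMean, abs_mul, abs_inv, Nat.abs_cast, ← div_eq_inv_mul]
  exact div_le_one_of_le₀ h (Nat.cast_nonneg _)

theorem card_inter_sat (hψ : A.HasReplicaExpansion κ ψ) {S : Finset (Fin n → ZMod 2)}
    (hS : S.Nonempty) (y : Y) (e : Fin k → Fin n) :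
    ((S ∩ sat A e y).card : ℝ) = κ * S.card * (1 - edgeMean ψ S y e) := by
  classical
  have hs : (S.card : ℝ) ≠ 0 := Nat.cast_ne_zero.2 hS.card_ne_zero
  have h : ((S ∩ sat A e y).card : ℝ) = ∑ x ∈ S, κ * (1 - ψ y (x ∘ e)) := by
    rw [← Finset.filter_mem_eq_inter, Finset.natCast_card_filter]
    refine Finset.sum_congr rfl fun x _ => ?_
    rw [← hψ.auth_eq, Set.indicator_apply]
    simp
  rw [h, ← Finset.mul_sum, Finset.sum_sub_distrib, edgeMean]
  simp only [Finset.sum_const, nsmul_eq_mul]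
  field_simp

/-- Up to terms that do not depend on the edge, the edge entropy is a positive multiple of a sum of
power series in the posterior means `edgeMean`. -/
theorem edgeEntropy_eq (hψ : A.HasReplicaExpansion κ ψ) {S : Finset (Fin n → ZMod 2)}
    (hS : S.Nonempty) (e : Fin k → Fin n) :
    edgeEntropy A S e = (S.card * Real.log (κ * S.card) +
        (A.size : ℝ)⁻¹ * (S.card * A.size - κ * S.card * Fintype.card Y)) +
      (A.size : ℝ)⁻¹ * (κ * S.card) * ∑ y, entropySeries (edgeMean ψ S y e) := by
  have hs : (0 : ℝ) < S.card := Nat.cast_pos.2 hS.card_pos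
  have hκ := hψ.pos
  have ha := A.size_cast_pos
  have hsum := sum_card_inter_sat A S e
  simp only [card_inter_sat hψ hS] at hsum
  have hterm : ∀ y, volLogVol (S ∩ sat A e y) =
      κ * S.card * (1 - edgeMean ψ S y e) * (Real.log (κ * S.card) + 1) - κ * S.card +
        κ * S.card * entropySeries (edgeMean ψ S y e) := by
    intro y
    rw [volLogVol, card_inter_sat hψ hS, entropySeries]
    rcases eq_or_ne (1 - edgeMean ψ S y e) 0 with h | h
    · have : edgeMean ψ S y e = 1 := by linarith
      simp [this]
    · rw [Real.log_mul (by positivity) h]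
      ring
  rw [edgeEntropy]
  simp only [hterm]
  rw [Finset.sum_add_distrib, Finset.sum_sub_distrib, ← Finset.sum_mul, hsum]
  simp only [Finset.sum_const, Finset.card_univ, nsmul_eq_mul]
  rw [← Finset.mul_sum]
  generalize ∑ y, entropySeries (edgeMean ψ S y e) = E
  field_simp
  ring

/-- The `l`-th powers of the posterior means are means over `l` independent replicas drawn from `S`.
-/
theorem blockDefect_sum_edgeMean_pow_nonpos (hψ : A.HasReplicaExpansion κ ψ) (hn₁ : 0 < n₁)
    (hn₂ : 0 < n₂) (S : Finset (Fin (n₁ + n₂) → ZMod 2)) (l : ℕ) :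
    blockDefect (fun e => ∑ y, edgeMean ψ S y e ^ l) ≤ 0 := by
  obtain ⟨T, _, w, G, hw, hG, hexp⟩ := hψ.expand l
  have h : ∀ e : Fin k → Fin (n₁ + n₂), ∑ y, edgeMean ψ S y e ^ l =
      ∑ X ∈ Fintype.piFinset fun _ : Fin l => S, ∑ τ,
        ((S.card : ℝ)⁻¹ ^ l * w τ) * ∏ i, G τ fun j => X j (e i) := by
    intro e
    simp only [edgeMean, mul_pow, Finset.sum_pow']
    rw [← Finset.mul_sum, Finset.sum_comm, Finset.mul_sum]
    refine Finset.sum_congr rfl fun X _ => ?_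
    rw [hexp fun j => X j ∘ e, Finset.mul_sum]
    exact Finset.sum_congr rfl fun τ _ => (mul_assoc _ _ _).symm
  simp only [h, blockDefect_sum, blockDefect_mul]
  refine Finset.sum_nonpos fun X _ => Finset.sum_nonpos fun τ _ =>
    mul_nonpos_of_nonneg_of_nonpos (mul_nonneg (by positivity) (hw τ)) ?_
  exact blockDefect_prod_nonpos hn₁ hn₂ (fun v => G τ fun j => X j v)
    (hG.imp_left fun hG v => hG _ _)

theorem blockDefect_edgeEntropy_nonpos (hψ : A.HasReplicaExpansion κ ψ) (hn₁ : 0 < n₁)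
    (hn₂ : 0 < n₂) (S : Finset (Fin (n₁ + n₂) → ZMod 2)) :
    blockDefect (fun e => edgeEntropy A S e) ≤ 0 := by
  rcases S.eq_empty_or_nonempty with rfl | hS
  · simp [edgeEntropy, volLogVol, blockDefect, tupleMean]
  simp only [edgeEntropy_eq hψ hS]
  rw [blockDefect_const_add hn₁ hn₂, blockDefect_mul]
  have hκ := hψ.pos
  refine mul_nonpos_of_nonneg_of_nonpos (by positivity) ?_
  -- The power series converges for arguments in the open disc only, hence the factor `η < 1`.
  have hη : ∀ η ∈ Set.Ioo (0 : ℝ) 1,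
      blockDefect (fun e => ∑ y, entropySeries (η * edgeMean ψ S y e)) ≤ 0 := by
    intro η hη
    have hlt : ∀ y e, |η * edgeMean ψ S y e| < 1 := by
      intro y e
      rw [abs_mul, abs_of_pos hη.1]
      exact (mul_le_of_le_one_right hη.1.le (abs_edgeMean_le hψ S y e)).trans_lt hη.2
    refine hasSum_le (fun l => ?_) (hasSum_blockDefect fun e =>
      hasSum_sum fun y (_ : y ∈ Finset.univ) => hasSum_entropySeries (hlt y e)) hasSum_zero
    simp only [mul_pow, ← mul_assoc, ← Finset.mul_sum]
    rw [blockDefect_mul]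
    refine mul_nonpos_of_nonneg_of_nonpos (mul_nonneg (sub_nonneg.2 ?_) (by
      have := hη.1
      positivity)) (blockDefect_sum_edgeMean_pow_nonpos hψ hn₁ hn₂ S _)
    gcongr
    norm_num
  refine le_of_tendsto (tendsto_blockDefect fun e => ?_)
    (Filter.mem_of_superset (Ioo_mem_nhdsLT (zero_lt_one' ℝ)) hη)
  refine tendsto_finsetSum _ fun y _ => ?_
  have hc : Continuous fun η : ℝ => entropySeries (η * edgeMean ψ S y e) :=
    continuous_entropySeries.comp (continuous_id.mul continuous_const)
  simpa using (hc.tendsto 1).mono_left nhdsWithin_le_nhds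

/-- Moving constraints from the tuples of all vertices to the tuples inside the two blocks can
only increase the entropy of the solutions. -/
theorem annealed_tuples_le (hψ : A.HasReplicaExpansion κ ψ) (hn₁ : 0 < n₁) (hn₂ : 0 < n₂) :
    ((n₁ : ℝ) + n₂) • annealed A (id : (Fin k → Fin (n₁ + n₂)) → _) volLogVol ≤
      (n₁ : ℝ) • annealed A (fun e : Fin k → Fin n₁ => Fin.castAdd n₂ ∘ e) volLogVol +
      (n₂ : ℝ) • annealed A (fun e : Fin k → Fin n₂ => Fin.natAdd n₁ ∘ e) volLogVol := by
  intro S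
  have h := blockDefect_edgeEntropy_nonpos hψ hn₁ hn₂ S
  rw [blockDefect, sub_nonpos] at h
  simpa [annealed_volLogVol, tupleMean] using h

end superadditive

/-! ### Independent blocks and Poisson numbers of constraints -/

section blocks

variable {k n₁ n₂ : ℕ} {Y : Type} {A : CSP k Y}

/-- The assignments of `[n₁ + n₂]` whose restrictions to the two blocks are in `S₁` and `S₂`. -/
def blockProd (S₁ : Finset (Fin n₁ → ZMod 2)) (S₂ : Finset (Fin n₂ → ZMod 2)) :
    Finset (Fin (n₁ + n₂) → ZMod 2) :=
  (S₁ ×ˢ S₂).map (Fin.appendEquiv n₁ n₂).toEmbedding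

theorem append_mem_blockProd {S₁ : Finset (Fin n₁ → ZMod 2)} {S₂ : Finset (Fin n₂ → ZMod 2)}
    {x₁ : Fin n₁ → ZMod 2} {x₂ : Fin n₂ → ZMod 2} :
    Fin.append x₁ x₂ ∈ blockProd S₁ S₂ ↔ x₁ ∈ S₁ ∧ x₂ ∈ S₂ := by
  have := Finset.mem_map' (Fin.appendEquiv (α := ZMod 2) n₁ n₂).toEmbedding (a := (x₁, x₂))
    (s := S₁ ×ˢ S₂)
  rw [Finset.mem_product] at this
  exact this

theorem card_blockProd (S₁ : Finset (Fin n₁ → ZMod 2)) (S₂ : Finset (Fin n₂ → ZMod 2)) :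
    (blockProd S₁ S₂).card = S₁.card * S₂.card := by
  rw [blockProd, Finset.card_map, Finset.card_product]

theorem blockProd_univ :
    blockProd (Finset.univ : Finset (Fin n₁ → ZMod 2)) (Finset.univ : Finset (Fin n₂ → ZMod 2)) =
      Finset.univ := by
  rw [blockProd, Finset.univ_product_univ, Finset.map_univ_equiv]

theorem exists_append (x : Fin (n₁ + n₂) → ZMod 2) : ∃ x₁ x₂, Fin.append x₁ x₂ = x :=
  ⟨_, _, Fin.append_castAdd_natAdd⟩

theorem blockProd_inter_sat_left (S₁ : Finset (Fin n₁ → ZMod 2)) (S₂ : Finset (Fin n₂ → ZMod 2))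
    (e : Fin k → Fin n₁) (y : Y) :
    blockProd S₁ S₂ ∩ sat A (Fin.castAdd n₂ ∘ e) y = blockProd (S₁ ∩ sat A e y) S₂ := by
  ext x
  obtain ⟨x₁, x₂, rfl⟩ := exists_append x
  have : Fin.append x₁ x₂ ∘ Fin.castAdd n₂ ∘ e = x₁ ∘ e := by
    ext i
    simp
  simp only [Finset.mem_inter, append_mem_blockProd, mem_sat, this]
  tauto

theorem blockProd_inter_sat_right (S₁ : Finset (Fin n₁ → ZMod 2)) (S₂ : Finset (Fin n₂ → ZMod 2))
    (e : Fin k → Fin n₂) (y : Y) :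
    blockProd S₁ S₂ ∩ sat A (Fin.natAdd n₁ ∘ e) y = blockProd S₁ (S₂ ∩ sat A e y) := by
  ext x
  obtain ⟨x₁, x₂, rfl⟩ := exists_append x
  have : Fin.append x₁ x₂ ∘ Fin.natAdd n₁ ∘ e = x₂ ∘ e := by
    ext i
    simp
  simp only [Finset.mem_inter, append_mem_blockProd, mem_sat, this]
  tauto

variable [Fintype Y]

theorem volLogVol_blockProd (S₁ : Finset (Fin n₁ → ZMod 2)) (S₂ : Finset (Fin n₂ → ZMod 2)) :
    volLogVol (blockProd S₁ S₂) = volLogVol S₁ * vol S₂ + vol S₁ * volLogVol S₂ := by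
  simp only [volLogVol, vol, card_blockProd, Nat.cast_mul]
  rcases eq_or_ne (S₁.card : ℝ) 0 with h₁ | h₁
  · simp [h₁]
  rcases eq_or_ne (S₂.card : ℝ) 0 with h₂ | h₂
  · simp [h₂]
  rw [Real.log_mul h₁ h₂]
  ring

/-- The evolution of an additive functional of a pair of independent blocks, when each constraint
falls into the two blocks with the probabilities `p` and `q`. -/
theorem annealed_blocks_pow {ι₁ ι₂ : Type} [Fintype ι₁] [Nonempty ι₁] [Fintype ι₂] [Nonempty ι₂]
    (emb₁ : ι₁ → Fin k → Fin n₁) (emb₂ : ι₂ → Fin k → Fin n₂) (p q : ℝ) (M : ℕ)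
    {F : Finset (Fin (n₁ + n₂) → ZMod 2) → ℝ} {f₁ : Finset (Fin n₁ → ZMod 2) → ℝ}
    {f₂ : Finset (Fin n₂ → ZMod 2) → ℝ}
    (hF : ∀ S₁ S₂, F (blockProd S₁ S₂) = f₁ S₁ * vol S₂ + vol S₁ * f₂ S₂)
    (S₁ : Finset (Fin n₁ → ZMod 2)) (S₂ : Finset (Fin n₂ → ZMod 2)) :
    ((p • annealed A (fun e => Fin.castAdd n₂ ∘ emb₁ e) +
        q • annealed A (fun e => Fin.natAdd n₁ ∘ emb₂ e)) ^ M) F (blockProd S₁ S₂) =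
      ((p • annealed A emb₁ + q • 1) ^ M) f₁ S₁ * vol S₂ +
        vol S₁ * ((q • annealed A emb₂ + p • 1) ^ M) f₂ S₂ := by
  induction M generalizing F f₁ f₂ with
  | zero => exact hF S₁ S₂
  | succ M ih =>
    simp only [pow_succ, Module.End.mul_apply]
    refine ih fun S₁ S₂ => ?_
    have h₁ : annealed A (fun e => Fin.castAdd n₂ ∘ emb₁ e) F (blockProd S₁ S₂) =
        annealed A emb₁ f₁ S₁ * vol S₂ + annealed A emb₁ vol S₁ * f₂ S₂ := by
      simp only [annealed, thin_apply, blockProd_inter_sat_left, hF, mul_add,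
        Finset.sum_add_distrib, Finset.sum_mul, mul_assoc]
    have h₂ : annealed A (fun e => Fin.natAdd n₁ ∘ emb₂ e) F (blockProd S₁ S₂) =
        f₁ S₁ * annealed A emb₂ vol S₂ + vol S₁ * annealed A emb₂ f₂ S₂ := by
      simp only [annealed, thin_apply, blockProd_inter_sat_right, hF, mul_add,
        Finset.sum_add_distrib, Finset.mul_sum, mul_left_comm]
    rw [annealed_vol] at h₁ h₂
    simp only [LinearMap.add_apply, LinearMap.smul_apply, Module.End.one_apply, Pi.add_apply,
      Pi.smul_apply, smul_eq_mul, h₁, h₂]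
    ring

end blocks

section poisson

theorem integrable_poisson_of_bounded {b : ℕ → ℝ} {c : ℝ} (hb : ∀ M, |b M| ≤ c) (r : ℝ≥0) :
    Integrable b (poissonMeasure r) :=
  Integrable.of_bound (Measurable.of_discrete).aestronglyMeasurable c (.of_forall hb)

/-- Poisson thinning: if each of a Poisson number of events is kept with probability `p`, the
number of events that are kept is a Poisson variable as well. -/
theorem integral_poisson_thinning {b : ℕ → ℝ} {c : ℝ} (hb : ∀ M, |b M| ≤ c) {r r₁ r₂ : ℝ≥0}
    {p q : ℝ} (h₁ : (r : ℝ) * p = r₁) (h₂ : (r : ℝ) * q = r₂) (hr : r = r₁ + r₂) :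
    ∫ M, ∑ ij ∈ Finset.HasAntidiagonal.antidiagonal M,
      (M.choose ij.1 : ℝ) * (p ^ ij.1 * q ^ ij.2) * b ij.1 ∂poissonMeasure r =
        ∫ j, b j ∂poissonMeasure r₁ := by
  have hs₁ := (integrable_poissonMeasure_iff.1 (integrable_poisson_of_bounded hb r₁))
  have hs₂ := (hasSum_one_poissonMeasure r₂).summable
  have key := tsum_mul_tsum_eq_tsum_sum_antidiagonal_of_summable_norm
    (f := fun j => Real.exp (-r₁) * r₁ ^ j / j.factorial * b j)
    (g := fun j : ℕ => Real.exp (-r₂) * r₂ ^ j / j.factorial)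
    (hs₁.congr fun j => by
      rw [norm_mul, Real.norm_of_nonneg (r := Real.exp (-r₁) * r₁ ^ j / j.factorial)
        (by positivity)])
    hs₂.norm
  rw [(hasSum_one_poissonMeasure r₂).tsum_eq, mul_one] at key
  rw [integral_poissonMeasure, integral_poissonMeasure]
  simp only [smul_eq_mul]
  rw [key]
  refine tsum_congr fun M => ?_
  rw [Finset.mul_sum]
  refine Finset.sum_congr rfl fun ij hij => ?_
  rw [Finset.HasAntidiagonal.mem_antidiagonal] at hij
  obtain ⟨i, j⟩ := ij
  obtain rfl : i + j = M := hij
  have hc : ((i + j).choose i : ℝ) * i.factorial * j.factorial = (i + j).factorial := by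
    rw [Nat.choose_symm_add]
    exact_mod_cast Nat.add_choose_mul_factorial_mul_factorial i j
  have hexp : Real.exp (-r) = Real.exp (-r₁) * Real.exp (-r₂) := by
    rw [← Real.exp_add, hr]
    push_cast
    ring_nf
  have hp : (r₁ : ℝ) ^ i = r ^ i * p ^ i := by rw [← h₁, mul_pow]
  have hq : (r₂ : ℝ) ^ j = r ^ j * q ^ j := by rw [← h₂, mul_pow]
  have hch : ((i + j).choose i : ℝ) ≠ 0 :=
    Nat.cast_ne_zero.2 (Nat.choose_pos (Nat.le_add_right i j)).ne'
  simp only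
  rw [hexp, hp, hq, ← hc, pow_add]
  field_simp

end poisson

section subadditive

variable {k : ℕ} {Y : Type} [Fintype Y] {A : CSP k Y} {κ : ℝ} {ψ : Y → (Fin k → ZMod 2) → ℝ}

theorem volLogVol_nonneg {n : ℕ} : 0 ≤ volLogVol (n := n) := fun _ =>
  mul_nonneg (Nat.cast_nonneg _) (Real.log_natCast_nonneg _)

theorem annealed_pow_volLogVol_nonneg {n : ℕ} {ι : Type} [Fintype ι] (emb : ι → Fin k → Fin n)
    (M : ℕ) : 0 ≤ (annealed A emb ^ M) volLogVol := by
  have := (positive_annealed A emb).pow M volLogVol_nonneg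
  rwa [map_zero] at this

theorem meanLog_nonneg {n : ℕ} {ι : Type} [Fintype ι] (emb : ι → Fin k → Fin n) (M : ℕ) :
    0 ≤ meanLog A emb M :=
  mul_nonneg (by positivity) (annealed_pow_volLogVol_nonneg emb M _)

theorem meanLog_le {n : ℕ} {ι : Type} [Fintype ι] [Nonempty ι] (emb : ι → Fin k → Fin n)
    (M : ℕ) : meanLog A emb M ≤ n * Real.log 2 := by
  refine (antitone_nat_of_succ_le (meanLog_succ_le A emb) (Nat.zero_le M)).trans (le_of_eq ?_)
  simp [meanLog, volLogVol, ZMod.card]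

theorem abs_meanLog_le {n : ℕ} {ι : Type} [Fintype ι] [Nonempty ι] (emb : ι → Fin k → Fin n)
    (M : ℕ) : |meanLog A emb M| ≤ n * Real.log 2 := by
  rw [abs_of_nonneg (meanLog_nonneg emb M)]
  exact meanLog_le emb M

theorem integrable_meanLog {n : ℕ} {ι : Type} [Fintype ι] [Nonempty ι] (emb : ι → Fin k → Fin n)
    (r : ℝ≥0) : Integrable (meanLog A emb) (poissonMeasure r) :=
  integrable_poisson_of_bounded (abs_meanLog_le emb) r

theorem meanLog_zero_vertices {ι : Type} [Fintype ι] (emb : ι → Fin k → Fin 0) (M : ℕ) :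
    meanLog A emb M = 0 := by
  have : volLogVol (n := 0) = 0 := by
    ext S
    have hS : S.card ≤ 1 := (Finset.card_le_univ S).trans (by simp)
    interval_cases h : S.card <;> simp [volLogVol, h]
  simp [meanLog, this]

/-- The mean entropy when each constraint of a sequence is discarded with probability `q`. -/
theorem meanLog_thinned {n : ℕ} {ι : Type} [Fintype ι] (emb : ι → Fin k → Fin n) (p q : ℝ)
    (M : ℕ) :
    (2 ^ n)⁻¹ * ((p • annealed A emb + q • 1) ^ M) volLogVol Finset.univ =
      ∑ ij ∈ Finset.HasAntidiagonal.antidiagonal M,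
        (M.choose ij.1 : ℝ) * (p ^ ij.1 * q ^ ij.2) * meanLog A emb ij.1 := by
  have hc : Commute (p • annealed A emb) (q • 1) := (Commute.one_right _).smul_right q
  rw [hc.add_pow']
  simp only [LinearMap.sum_apply, Finset.sum_apply, Finset.mul_sum]
  refine Finset.sum_congr rfl fun ij _ => ?_
  rw [smul_pow, smul_pow, one_pow, smul_mul_smul_comm, mul_one, meanLog,
    ← Nat.cast_smul_eq_nsmul ℝ]
  simp only [LinearMap.smul_apply, Pi.smul_apply, smul_eq_mul]
  ring

/-- The mean entropy of the planted CSP in which the edges are `k`-tuples of vertices, possibly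
with repetitions, and their number is a Poisson variable of parameter `α n`. -/
def poissonMeanLog (A : CSP k Y) (α : ℝ≥0) (n : ℕ) : ℝ :=
  ∫ M, meanLog A (id : (Fin k → Fin n) → _) M ∂poissonMeasure (α * n)

theorem subadditive_poissonMeanLog (hψ : A.HasReplicaExpansion κ ψ) (α : ℝ≥0) :
    Subadditive (poissonMeanLog A α) := by
  intro n₁ n₂
  rcases Nat.eq_zero_or_pos n₁ with rfl | hn₁
  · have : poissonMeanLog A α 0 = 0 := by simp [poissonMeanLog, meanLog_zero_vertices]
    rw [this, zero_add, zero_add]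
  rcases Nat.eq_zero_or_pos n₂ with rfl | hn₂
  · have : poissonMeanLog A α 0 = 0 := by simp [poissonMeanLog, meanLog_zero_vertices]
    rw [this, add_zero, add_zero]
  have : NeZero n₁ := ⟨hn₁.ne'⟩
  have : NeZero n₂ := ⟨hn₂.ne'⟩
  have : NeZero (n₁ + n₂) := ⟨by omega⟩
  have p1 : (0 : ℝ) < n₁ := Nat.cast_pos.2 hn₁
  have p2 : (0 : ℝ) < n₂ := Nat.cast_pos.2 hn₂
  set p : ℝ := n₁ / (n₁ + n₂) with hp
  set q : ℝ := n₂ / (n₁ + n₂) with hq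
  have hTU : annealed A (id : (Fin k → Fin (n₁ + n₂)) → _) volLogVol ≤
      (p • annealed A (fun e : Fin k → Fin n₁ => Fin.castAdd n₂ ∘ e) +
        q • annealed A fun e : Fin k → Fin n₂ => Fin.natAdd n₁ ∘ e) volLogVol := by
    intro S
    have h := annealed_tuples_le hψ hn₁ hn₂ S
    simp only [Pi.add_apply, Pi.smul_apply, smul_eq_mul, LinearMap.add_apply,
      LinearMap.smul_apply] at h ⊢
    rw [← le_div_iff₀' (by positivity)] at h
    refine h.trans (le_of_eq ?_)
    rw [hp, hq]
    ring
  have hpow := fun M => (positive_annealed A _).pow_le_pow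
    (((positive_annealed A _).smul (by positivity)).add
      ((positive_annealed A _).smul (by positivity)))
    (((commute_annealed A _ _).smul_right p).add_right ((commute_annealed A _ _).smul_right q))
    hTU M Finset.univ
  have hM : ∀ M, meanLog A (id : (Fin k → Fin (n₁ + n₂)) → _) M ≤
      (∑ ij ∈ Finset.HasAntidiagonal.antidiagonal M, (M.choose ij.1 : ℝ) * (p ^ ij.1 * q ^ ij.2) *
        meanLog A (id : (Fin k → Fin n₁) → _) ij.1) +
      ∑ ij ∈ Finset.HasAntidiagonal.antidiagonal M, (M.choose ij.1 : ℝ) * (q ^ ij.1 * p ^ ij.2) *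
        meanLog A (id : (Fin k → Fin n₂) → _) ij.1 := by
    intro M
    have h := (hpow M).trans_eq ((congrArg _ blockProd_univ.symm).trans
      (annealed_blocks_pow id id p q M volLogVol_blockProd _ _))
    rw [vol_univ, vol_univ] at h
    rw [← meanLog_thinned, ← meanLog_thinned]
    refine (mul_le_mul_of_nonneg_left h (by positivity : (0 : ℝ) ≤ (2 ^ (n₁ + n₂))⁻¹)).trans
      (le_of_eq ?_)
    rw [pow_add]
    field_simp
  have hpq : p + q = 1 := by
    rw [hp, hq]
    field_simp
  have hbound : ∀ (a b : ℝ) (n : ℕ) [NeZero n] (M : ℕ), 0 ≤ a → 0 ≤ b → a + b = 1 →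
      |∑ ij ∈ Finset.HasAntidiagonal.antidiagonal M, (M.choose ij.1 : ℝ) * (a ^ ij.1 * b ^ ij.2) *
        meanLog A (id : (Fin k → Fin n) → _) ij.1| ≤ n * Real.log 2 := by
    intro a b n _ M ha hb hab
    refine (Finset.abs_sum_le_sum_abs _ _).trans ?_
    have hone : ∑ ij ∈ Finset.HasAntidiagonal.antidiagonal M,
        (M.choose ij.1 : ℝ) * (a ^ ij.1 * b ^ ij.2) = 1 := by
      have := (Commute.all a b).add_pow' M
      rw [hab, one_pow] at this
      rw [this]
      simp only [nsmul_eq_mul]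
    rw [← one_mul ((n : ℝ) * Real.log 2), ← hone, Finset.sum_mul]
    refine Finset.sum_le_sum fun ij _ => ?_
    rw [abs_mul, abs_of_nonneg (by positivity)]
    gcongr
    exact abs_meanLog_le _ _
  have hp0 : 0 ≤ p := by positivity
  have hq0 : 0 ≤ q := by positivity
  have hi₁ := integrable_poisson_of_bounded
    (fun M => hbound p q n₁ M hp0 hq0 hpq) (α * (n₁ + n₂ : ℕ))
  have hi₂ := integrable_poisson_of_bounded
    (fun M => hbound q p n₂ M hq0 hp0 (by rwa [add_comm])) (α * (n₁ + n₂ : ℕ))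
  refine (integral_mono (integrable_meanLog _ _) (hi₁.add hi₂) hM).trans (le_of_eq ?_)
  rw [integral_add' hi₁ hi₂]
  have e₁ : ((α * (n₁ + n₂ : ℕ) : ℝ≥0) : ℝ) * p = (α * n₁ : ℝ≥0) := by
    rw [hp]
    push_cast
    field_simp
  have e₂ : ((α * (n₁ + n₂ : ℕ) : ℝ≥0) : ℝ) * q = (α * n₂ : ℝ≥0) := by
    rw [hq]
    push_cast
    field_simp
  rw [integral_poisson_thinning (abs_meanLog_le _) e₁ e₂ (by push_cast; ring),
    integral_poisson_thinning (abs_meanLog_le _) e₂ e₁ (by push_cast; ring)]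
  rfl

theorem tendsto_poissonMeanLog_div (hψ : A.HasReplicaExpansion κ ψ) (α : ℝ≥0) :
    ∃ C, Tendsto (fun n : ℕ => poissonMeanLog A α n / n) atTop (𝓝 C) := by
  refine ⟨_, (subadditive_poissonMeanLog hψ α).tendsto_lim ⟨0, ?_⟩⟩
  rintro _ ⟨n, rfl⟩
  exact div_nonneg (integral_nonneg fun M => meanLog_nonneg _ M) (Nat.cast_nonneg _)

end subadditive

/-! ### Edges as sets and edges as tuples -/

section edges

variable {k n : ℕ} {Y : Type} [Fintype Y] {A : CSP k Y}

/-- The vertices of an edge in increasing order. -/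
def edgeTuple (I : Edge n k) : Fin k → Fin n := I.1.orderEmbOfFin I.2

theorem edgeEntropy_comp_perm (hA : A.PermInvariant) (S : Finset (Fin n → ZMod 2))
    (e : Fin k → Fin n) (π : Equiv.Perm (Fin k)) :
    edgeEntropy A S (e ∘ π) = edgeEntropy A S e := by
  obtain ⟨σ, hσ⟩ := hA π
  rw [edgeEntropy, edgeEntropy, ← σ.sum_comp]
  congr 1
  refine Finset.sum_congr rfl fun y _ => ?_
  congr 2
  ext x
  simp only [mem_sat]
  exact hσ (x ∘ e) y

theorem bijective_edgeTuple_comp_perm :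
    Function.Bijective fun p : Edge n k × Equiv.Perm (Fin k) =>
      (⟨edgeTuple p.1 ∘ p.2, (p.1.1.orderEmbOfFin p.1.2).injective.comp p.2.injective⟩ :
        {e : Fin k → Fin n // Function.Injective e}) := by
  constructor
  · rintro ⟨I, π⟩ ⟨J, ρ⟩ h
    have h : edgeTuple I ∘ π = edgeTuple J ∘ ρ := congrArg Subtype.val h
    have hIJ : I = J := by
      have := congrArg Set.range h
      rw [EquivLike.range_comp, EquivLike.range_comp, edgeTuple, edgeTuple,
        Finset.range_orderEmbOfFin, Finset.range_orderEmbOfFin] at this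
      exact Subtype.ext (Finset.coe_injective this)
    subst hIJ
    refine Prod.ext rfl (Equiv.ext fun i => ?_)
    exact (I.1.orderEmbOfFin I.2).injective (congrFun h i)
  · rintro ⟨e, he⟩
    have hcard : (Finset.univ.image e).card = k := by
      rw [Finset.card_image_of_injective _ he, Finset.card_univ, Fintype.card_fin]
    let f : Fin k → Fin k := fun i =>
      ((Finset.univ.image e).orderIsoOfFin hcard).symm ⟨e i, by simp⟩
    have hf : Function.Injective f := fun i j h => by
      have := ((Finset.univ.image e).orderIsoOfFin hcard).symm.injective h
      exact he (congrArg Subtype.val this)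
    refine ⟨⟨⟨Finset.univ.image e, hcard⟩,
      Equiv.ofBijective f (Finite.injective_iff_bijective.1 hf)⟩,
      Subtype.ext (funext fun i => ?_)⟩
    change (Finset.univ.image e).orderEmbOfFin hcard (f i) = e i
    rw [← Finset.coe_orderIsoOfFin_apply, OrderIso.apply_symm_apply]

open Classical in
theorem sum_injective_eq (f : (Fin k → Fin n) → ℝ)
    (hf : ∀ (e : Fin k → Fin n) (π : Equiv.Perm (Fin k)), f (e ∘ π) = f e) :
    ∑ e with Function.Injective e, f e = k.factorial * ∑ I : Edge n k, f (edgeTuple I) := by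
  rw [Finset.sum_subtype (p := Function.Injective) _ (fun e => by simp),
    ← Function.Bijective.sum_comp bijective_edgeTuple_comp_perm (fun e => f e.1),
    Fintype.sum_prod_type]
  simp only [hf, Finset.sum_const, Finset.card_univ, Fintype.card_perm, Fintype.card_fin,
    nsmul_eq_mul, Finset.mul_sum]

theorem card_edge : Fintype.card (Edge n k) = n.choose k := by
  rw [Fintype.card_finset_len, Fintype.card_fin]

/-- The probability that a uniformly random `k`-tuple of vertices has a repetition. -/
def repetitionProb (k n : ℕ) : ℝ := 1 - n.descFactorial k / (n : ℝ) ^ k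

theorem tendsto_repetitionProb (k : ℕ) : Tendsto (repetitionProb k) atTop (𝓝 0) := by
  have h := (isEquivalent_descFactorial k)
  rw [Asymptotics.isEquivalent_iff_tendsto_one] at h
  · have h1 := (tendsto_const_nhds (x := (1 : ℝ))).sub h
    rw [sub_self] at h1
    exact h1
  · filter_upwards [eventually_gt_atTop 0] with n hn
    positivity

/-- The mean over all tuples differs from the mean over the tuples without repetitions, which is the
mean over the edges, only through the tuples with repetitions. -/
theorem abs_annealed_sub_le (hA : A.PermInvariant) (hn : 0 < n) (hkn : k ≤ n)
    (S : Finset (Fin n → ZMod 2)) :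
    |annealed A (id : (Fin k → Fin n) → _) volLogVol S -
        annealed A (edgeTuple (n := n) (k := k)) volLogVol S| ≤
      repetitionProb k n * edgeBound A * vol S := by
  classical
  have hne : Nonempty (Edge n k) := by
    rw [← Fintype.card_pos_iff, card_edge]
    exact Nat.choose_pos hkn
  set a := annealed A (edgeTuple (n := n) (k := k)) volLogVol S with ha
  have hN : (0 : ℝ) < (n : ℝ) ^ k := by positivity
  have hinj : ∑ e : Fin k → Fin n with Function.Injective e, (edgeEntropy A S e - a) = 0 := by
    rw [sum_injective_eq (fun e => edgeEntropy A S e - a)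
      (fun e π => by rw [edgeEntropy_comp_perm hA]), Finset.sum_sub_distrib]
    have : (Fintype.card (Edge n k) : ℝ) ≠ 0 := Nat.cast_ne_zero.2 Fintype.card_ne_zero
    rw [ha, annealed_volLogVol]
    simp only [Finset.sum_const, Finset.card_univ, nsmul_eq_mul]
    field_simp
    simp
  have hcardinj : ((Finset.univ.filter fun e : Fin k → Fin n => Function.Injective e).card : ℝ) =
      n.descFactorial k := by
    have := sum_injective_eq (n := n) (k := k) (fun _ => 1) (fun _ _ => rfl)
    simp only [Finset.sum_const, nsmul_eq_mul, mul_one, Finset.card_univ, card_edge] at this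
    rw [this, Nat.descFactorial_eq_factorial_mul_choose]
    push_cast
    rfl
  have hcardnot : ((Finset.univ.filter fun e : Fin k → Fin n => ¬ Function.Injective e).card : ℝ) =
      (n : ℝ) ^ k - n.descFactorial k := by
    have := Finset.card_filter_add_card_filter_not (s := Finset.univ)
      (fun e : Fin k → Fin n => Function.Injective e)
    rw [← hcardinj, eq_sub_iff_add_eq']
    exact_mod_cast this.trans (by simp)
  have hdiff : annealed A (id : (Fin k → Fin n) → _) volLogVol S - a =
      ((n : ℝ) ^ k)⁻¹ * ∑ e : Fin k → Fin n with ¬ Function.Injective e,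
        (edgeEntropy A S e - a) := by
    have h := Finset.sum_filter_add_sum_filter_not Finset.univ
      (fun e : Fin k → Fin n => Function.Injective e) (fun e => edgeEntropy A S e - a)
    rw [hinj, zero_add] at h
    rw [h, annealed_volLogVol, Finset.sum_sub_distrib]
    simp only [id, Finset.sum_const, Finset.card_univ, Fintype.card_pi_const, Fintype.card_fin,
      nsmul_eq_mul]
    push_cast
    field_simp
  have hL := edgeBound_nonneg A
  have ha1 : a ≤ volLogVol S := annealed_volLogVol_le A _ S
  have ha2 : volLogVol S - edgeBound A * vol S ≤ a := by
    have := le_annealed_volLogVol A (edgeTuple (n := n) (k := k)) S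
    simp only [Pi.add_apply, Pi.smul_apply, smul_eq_mul] at this
    linarith
  have hb : ∀ e : Fin k → Fin n, |edgeEntropy A S e - a| ≤ edgeBound A * vol S := by
    intro e
    have h1 := edgeEntropy_le A S e
    have h2 := le_edgeEntropy A S e
    rw [abs_le]
    constructor <;> linarith
  rw [hdiff, abs_mul, abs_of_nonneg (by positivity)]
  have hsum := (Finset.abs_sum_le_sum_abs (fun e : Fin k → Fin n => edgeEntropy A S e - a)
    (Finset.univ.filter fun e => ¬ Function.Injective e)).trans
    (Finset.sum_le_sum fun e _ => hb e)
  rw [Finset.sum_const, nsmul_eq_mul, hcardnot] at hsum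
  rw [inv_mul_le_iff₀ hN]
  refine hsum.trans (le_of_eq ?_)
  rw [repetitionProb]
  field_simp

theorem abs_meanLog_tuples_sub_le (hA : A.PermInvariant) (hn : 0 < n) (hkn : k ≤ n) (M : ℕ) :
    |meanLog A (id : (Fin k → Fin n) → _) M - meanLog A (edgeTuple (n := n) (k := k)) M| ≤
      M * (repetitionProb k n * edgeBound A) := by
  have hne : Nonempty (Edge n k) := by
    rw [← Fintype.card_pos_iff, card_edge]
    exact Nat.choose_pos hkn
  have : NeZero n := ⟨hn.ne'⟩
  have h : ∀ S, |_| ≤ _ := fun S => abs_annealed_sub_le hA hn hkn S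
  have h1 := Positive.pow_le_pow_add (positive_annealed A (id : (Fin k → Fin n) → _))
    (positive_annealed A edgeTuple) (commute_annealed A _ _) (annealed_vol A _)
    (annealed_vol A _) (g := volLogVol) (δ := repetitionProb k n * edgeBound A)
    (fun S => by
      have := (abs_le.1 (h S)).2
      simp only [Pi.add_apply, Pi.smul_apply, smul_eq_mul]
      linarith) M Finset.univ
  have h2 := Positive.pow_le_pow_add (positive_annealed A edgeTuple)
    (positive_annealed A (id : (Fin k → Fin n) → _)) (commute_annealed A _ _) (annealed_vol A _)
    (annealed_vol A _) (g := volLogVol) (δ := repetitionProb k n * edgeBound A)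
    (fun S => by
      have := (abs_le.1 (h S)).1
      simp only [Pi.add_apply, Pi.smul_apply, smul_eq_mul]
      linarith) M Finset.univ
  simp only [Pi.add_apply, Pi.smul_apply, smul_eq_mul, vol_univ] at h1 h2
  rw [meanLog, meanLog, ← mul_sub, abs_mul, abs_of_nonneg (by positivity),
    inv_mul_le_iff₀ (by positivity), abs_le]
  constructor <;> linarith

end edges

section poissonMoments

/-- The identity `E [M f(M)] = r E [f(M + 1)]` for a Poisson variable `M` of parameter `r`. -/
theorem hasSum_poisson_mul {r : ℝ≥0} {f : ℕ → ℝ} {a : ℝ}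
    (h : HasSum (fun M => Real.exp (-r) * r ^ M / M.factorial * f (M + 1)) a) :
    HasSum (fun M : ℕ => Real.exp (-r) * r ^ M / M.factorial * (M * f M)) (r * a) := by
  refine (hasSum_nat_add_iff' 1).1 ?_
  simp only [Finset.range_one, Finset.sum_singleton, Nat.cast_zero, zero_mul, mul_zero, sub_zero]
  convert! h.mul_left (r : ℝ) using 1
  ext M
  rw [Nat.factorial_succ]
  push_cast
  field_simp
  ring

theorem hasSum_poisson_id (r : ℝ≥0) :
    HasSum (fun M : ℕ => Real.exp (-r) * r ^ M / M.factorial * M) r := by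
  have h := hasSum_poisson_mul (f := fun _ => 1) (r := r) (a := 1)
    (by simpa using hasSum_one_poissonMeasure r)
  simpa only [mul_one] using h

theorem hasSum_poisson_sq (r : ℝ≥0) :
    HasSum (fun M : ℕ => Real.exp (-r) * r ^ M / M.factorial * (M : ℝ) ^ 2) (r * (r + 1)) := by
  have h := (hasSum_poisson_id r).add (hasSum_one_poissonMeasure r)
  have h2 := hasSum_poisson_mul (f := fun M => (M : ℝ)) (r := r) (a := r + 1) (by
    convert! h using 2
    push_cast
    ring)
  simpa [sq] using h2

theorem integrable_poisson_id (r : ℝ≥0) :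
    Integrable (fun M : ℕ => (M : ℝ)) (poissonMeasure r) := by
  rw [integrable_poissonMeasure_iff]
  simpa using (hasSum_poisson_id r).summable

theorem integral_poisson_id (r : ℝ≥0) : ∫ M, (M : ℝ) ∂poissonMeasure r = r := by
  rw [integral_poissonMeasure]
  exact (hasSum_poisson_id r).tsum_eq

theorem integrable_poisson_sub_sq (r : ℝ≥0) (a : ℝ) :
    Integrable (fun M : ℕ => ((M : ℝ) - a) ^ 2) (poissonMeasure r) := by
  have h2 : Integrable (fun M : ℕ => (M : ℝ) ^ 2) (poissonMeasure r) := by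
    rw [integrable_poissonMeasure_iff]
    simpa using (hasSum_poisson_sq r).summable
  refine ((h2.sub ((integrable_poisson_id r).const_mul (2 * a))).add
    (integrable_const (a ^ 2))).congr (.of_forall fun M => ?_)
  simp only [Pi.add_apply, Pi.sub_apply]
  ring

theorem integral_poisson_sub_sq (r : ℝ≥0) (a : ℝ) :
    ∫ M, ((M : ℝ) - a) ^ 2 ∂poissonMeasure r = r + (r - a) ^ 2 := by
  rw [integral_poissonMeasure]
  have h := ((hasSum_poisson_sq r).sub ((hasSum_poisson_id r).mul_left (2 * a))).add
    ((hasSum_one_poissonMeasure r).mul_left (a ^ 2))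
  refine HasSum.tsum_eq ?_
  convert! h using 1
  · ext M
    simp only [smul_eq_mul]
    ring
  · ring

end poissonMoments

/-! ### The Poisson hypergraph as a Poisson number of independent edges -/

section counts

variable {ι : Type} [DecidableEq ι]

/-- The multiplicities of the values of a finite sequence. -/
def counts {M : ℕ} (s : Fin M → ι) (I : ι) : ℕ := (Finset.univ.filter fun j => s j = I).card

theorem counts_cons {M : ℕ} (I : ι) (s : Fin M → ι) :
    counts (Fin.cons I s : Fin (M + 1) → ι) = counts s + Pi.single I 1 := by
  ext J
  rw [counts, Fin.card_filter_univ_succ]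
  simp only [Fin.cons_zero, Fin.cons_succ, Pi.add_apply, counts]
  by_cases h : I = J
  · subst h
    simp
  · simp [h, Ne.symm h]

variable [Fintype ι]

/-- The number of sequences with given multiplicities is a multinomial coefficient. -/
theorem card_counts_eq_mul (M : ℕ) (m : ι → ℕ) :
    (Finset.univ.filter fun s : Fin M → ι => counts s = m).card * ∏ I, (m I).factorial =
      if ∑ I, m I = M then M.factorial else 0 := by
  induction M generalizing m with
  | zero =>
    have h0 : ∀ s : Fin 0 → ι, counts s = 0 := fun s => funext fun I => by simp [counts]
    by_cases hm : m = 0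
    · subst hm
      simp [h0]
    · have : ¬ ∑ I, m I = 0 := by
        simpa [funext_iff] using hm
      simp [h0, Ne.symm hm, this]
  | succ M ih =>
    have hcard : (Finset.univ.filter fun s : Fin (M + 1) → ι => counts s = m).card =
        ∑ I, (Finset.univ.filter fun s : Fin M → ι => counts s + Pi.single I 1 = m).card := by
      simp only [Finset.card_filter]
      rw [← (Fin.consEquiv fun _ : Fin (M + 1) => ι).sum_comp, Fintype.sum_prod_type]
      refine Finset.sum_congr rfl fun I _ => Finset.sum_congr rfl fun s _ => ?_
      rw [← counts_cons]
      rfl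
    have hterm : ∀ I, (Finset.univ.filter fun s : Fin M → ι => counts s + Pi.single I 1 = m).card *
        ∏ I, (m I).factorial = m I * if ∑ I, m I = M + 1 then M.factorial else 0 := by
      intro I
      rcases Nat.eq_zero_or_pos (m I) with h | h
      · have : ∀ s : Fin M → ι, counts s + Pi.single I 1 ≠ m := by
          intro s hs
          have := congrFun hs I
          simp [h] at this
        simp [this, h]
      · obtain ⟨m', rfl⟩ : ∃ m' : ι → ℕ, m = m' + Pi.single I 1 := by
          refine ⟨m - Pi.single I 1, funext fun J => ?_⟩
          by_cases hJ : J = I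
          · subst hJ
            simp
            omega
          · simp [hJ]
        have hfac : ∏ J, ((m' + Pi.single I 1 : ι → ℕ) J).factorial =
            (m' I + 1) * ∏ J, (m' J).factorial := by
          rw [← Finset.mul_prod_erase _ _ (Finset.mem_univ I),
            ← Finset.mul_prod_erase _ (fun J => (m' J).factorial) (Finset.mem_univ I), ← mul_assoc]
          congr 1
          · simp [Nat.factorial_succ]
          · refine Finset.prod_congr rfl fun J hJ => ?_
            simp [Finset.ne_of_mem_erase hJ]
        have hsum : ∑ J, (m' + Pi.single I 1 : ι → ℕ) J = ∑ J, m' J + 1 := by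
          simp [Finset.sum_add_distrib]
        rw [hfac, hsum, mul_left_comm]
        simp only [add_left_inj, ih m', Pi.add_apply, Pi.single_eq_same]
    rw [hcard, Finset.sum_mul]
    simp only [hterm, ← Finset.sum_mul]
    split_ifs with h
    · rw [h, Nat.factorial_succ]
    · simp

/-- A product of Poisson distributions with equal parameters is the distribution of the
multiplicities of a Poisson number of independent, uniformly random elements. -/
theorem tsum_pi_poisson [Nonempty ι] (r : ℝ≥0) (Ψ : (ι → ℕ) → ℝ≥0∞) :
    ∑' m, (Measure.pi fun _ : ι => poissonMeasure r) {m} * Ψ m =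
      ∫⁻ M, ENNReal.ofReal (((Fintype.card ι : ℝ) ^ M)⁻¹) * ∑ s : Fin M → ι, Ψ (counts s)
        ∂poissonMeasure (Fintype.card ι * r) := by
  have hN : (Fintype.card ι : ℝ) ≠ 0 := Nat.cast_ne_zero.2 Fintype.card_ne_zero
  set c : ℕ → ℝ≥0∞ := fun M =>
    ENNReal.ofReal (Real.exp (-(Fintype.card ι * r)) * r ^ M / M.factorial) with hc
  have hmass : ∀ m : ι → ℕ, (Measure.pi fun _ : ι => poissonMeasure r) {m} =
      ∑' M, c M * (Finset.univ.filter fun s : Fin M → ι => counts s = m).card := by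
    intro m
    rw [Measure.pi_singleton, tsum_eq_single (∑ I, m I)]
    · simp only [poissonMeasure_singleton]
      rw [← ENNReal.ofReal_prod_of_nonneg fun I _ => by positivity, hc, ← ENNReal.ofReal_natCast,
        ← ENNReal.ofReal_mul (by positivity)]
      congr 1
      have h := card_counts_eq_mul (∑ I, m I) m
      rw [if_pos rfl] at h
      have h' : ((Finset.univ.filter fun s : Fin (∑ I, m I) → ι => counts s = m).card : ℝ) *
          ∏ I, ((m I).factorial : ℝ) = (∑ I, m I).factorial := by
        exact_mod_cast h
      have hfac : ∏ I, ((m I).factorial : ℝ) ≠ 0 :=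
        Finset.prod_ne_zero_iff.2 fun I _ => Nat.cast_ne_zero.2 (Nat.factorial_ne_zero _)
      rw [Finset.prod_div_distrib, Finset.prod_mul_distrib, Finset.prod_const,
        Finset.prod_pow_eq_pow_sum, ← Real.exp_nat_mul, Finset.card_univ, ← h']
      have hcard : ((Finset.univ.filter fun s : Fin (∑ I, m I) → ι => counts s = m).card : ℝ) ≠
          0 := by
        intro h0
        rw [h0, zero_mul] at h'
        exact Nat.cast_ne_zero.2 (Nat.factorial_ne_zero _) h'.symm
      rw [mul_neg]
      field_simp
    · intro M hM
      have h := card_counts_eq_mul M m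
      rw [if_neg (Ne.symm hM)] at h
      have hfac : ∏ I, (m I).factorial ≠ 0 :=
        Finset.prod_ne_zero_iff.2 fun I _ => Nat.factorial_ne_zero _
      rw [(Nat.mul_eq_zero.1 h).resolve_right hfac]
      simp
  rw [lintegral_countable']
  simp only [hmass, ← ENNReal.tsum_mul_right]
  rw [ENNReal.tsum_comm]
  refine tsum_congr fun M => ?_
  have hsum : ∑ s : Fin M → ι, Ψ (counts s) =
      ∑' m, ((Finset.univ.filter fun s : Fin M → ι => counts s = m).card : ℝ≥0∞) * Ψ m := by
    have : ∀ s : Fin M → ι, Ψ (counts s) = ∑' m, if counts s = m then Ψ m else 0 := fun s => by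
      rw [tsum_eq_single (counts s) fun m hm => if_neg (Ne.symm hm), if_pos rfl]
    simp only [this]
    rw [← Summable.tsum_finsetSum fun s _ => ENNReal.summable]
    refine tsum_congr fun m => ?_
    rw [← Finset.sum_filter, Finset.sum_const, nsmul_eq_mul]
  have hcM : c M = ENNReal.ofReal (((Fintype.card ι : ℝ) ^ M)⁻¹) *
      poissonMeasure (Fintype.card ι * r) {M} := by
    rw [poissonMeasure_singleton, ← ENNReal.ofReal_mul (by positivity), hc]
    push_cast
    rw [mul_pow]
    field_simp
  rw [hsum, mul_right_comm, ← hcM, ← ENNReal.tsum_mul_left]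
  simp only [mul_assoc]

end counts

section model

variable {k n : ℕ} {Y : Type} {A : CSP k Y}

/-- An enumeration of the constraints of a hypergraph by the terms of a sequence of edges with
the same multiplicities. -/
theorem exists_enumeration {ι : Type} [Fintype ι] [DecidableEq ι] {M : ℕ} (s : Fin M → ι) :
    ∃ η : (Σ I, Fin (counts s I)) ≃ Fin M, ∀ c, s (η c) = c.1 := by
  have hcard : ∀ I, Fintype.card (Fin (counts s I)) = Fintype.card {j // s j = I} := fun I => by
    rw [Fintype.card_fin, Fintype.card_subtype, counts]
  exact ⟨(Equiv.sigmaCongrRight fun I => Fintype.equivOfCardEq (hcard I)).trans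
    (Equiv.sigmaFiberEquiv s), fun c => (Fintype.equivOfCardEq (hcard c.1) c.2).2⟩

theorem kernel_apply (u : Fin k → ZMod 2) (y : Y) :
    A.kernel u y =
      ENNReal.ofReal (Set.indicator (A.auth u : Set Y) (fun _ => (A.size : ℝ)⁻¹) y) := by
  classical
  rw [CSP.kernel, PMF.uniformOfFinset_apply, A.card_auth, Set.indicator_apply]
  simp only [Finset.mem_coe]
  split_ifs
  · rw [ENNReal.ofReal_inv_of_pos A.size_cast_pos, ENNReal.ofReal_natCast]
  · simp

variable [Fintype Y]

/-- The labels of a hypergraph can be listed along any sequence of edges with its multiplicities,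
without changing the number of solutions. -/
theorem sum_obs_counts {M : ℕ} (s : Fin M → Edge n k) (x : Fin n → ZMod 2) (φ : ℕ → ℝ≥0∞) :
    ∑ y : Obs Y (counts s), (∏ I, ∏ i, A.kernel (restrict x I) (y I i)) *
        φ (numSolutions A ⟨x, counts s, y⟩) =
      ∑ y : Fin M → Y, (∏ j, A.kernel (restrict x (s j)) (y j)) *
        φ (Finset.univ.filter fun x' => ∀ j, x' ∈ sat A (edgeTuple (s j)) (y j)).card := by
  obtain ⟨η, hη⟩ := exists_enumeration s
  rw [← ((Equiv.arrowCongr η.symm (Equiv.refl Y)).trans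
    (Equiv.piCurry fun (I : Edge n k) (_ : Fin (counts s I)) => Y)).sum_comp]
  refine Finset.sum_congr rfl fun y _ => ?_
  have happ : ∀ I i, ((Equiv.arrowCongr η.symm (Equiv.refl Y)).trans
      (Equiv.piCurry fun (I : Edge n k) (_ : Fin (counts s I)) => Y)) y I i = y (η ⟨I, i⟩) :=
    fun _ _ => rfl
  congr 1
  · simp only [happ]
    rw [← η.prod_comp, Fintype.prod_sigma]
    simp only [hη]
  · congr 1
    rw [numSolutions, ← Set.ncard_coe_finset]
    congr 1
    ext x'
    simp only [happ, Set.mem_ofPred_eq, Finset.coe_filter, Finset.mem_univ, true_and, mem_sat]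
    rw [← η.forall_congr_right, Sigma.forall]
    simp only [hη]
    rfl

/-- The number of solutions of the random planted CSP, given that there are `M` constraints, and
the thinning chain. -/
theorem sum_sequences_eq (x : Fin n → ZMod 2) (M : ℕ) (φ : ℕ → ℝ) (hφ : ∀ z, 0 ≤ φ z) :
    ENNReal.ofReal (((Fintype.card (Edge n k) : ℝ) ^ M)⁻¹) * ∑ s : Fin M → Edge n k,
        ∑ y : Fin M → Y, (∏ j, A.kernel (restrict x (s j)) (y j)) * ENNReal.ofReal
          (φ (Finset.univ.filter fun x' => ∀ j, x' ∈ sat A (edgeTuple (s j)) (y j)).card) =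
      ENNReal.ofReal ((planted A (edgeTuple (n := n) (k := k)) x ^ M)
        (fun S => φ S.card) Finset.univ) := by
  classical
  have hw : ∀ c : Edge n k × Y, plantedWeight A edgeTuple x c = (Fintype.card (Edge n k) : ℝ)⁻¹ *
      Set.indicator (A.auth (restrict x c.1) : Set Y) (fun _ => (A.size : ℝ)⁻¹) c.2 := by
    intro c
    have : restrict x c.1 = x ∘ edgeTuple c.1 := rfl
    rw [plantedWeight, Set.indicator_apply, mul_ite, mul_zero, ← mul_inv, this]
    rfl
  have hind : ∀ (u : Fin k → ZMod 2) (y : Y),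
      0 ≤ Set.indicator (A.auth u : Set Y) (fun _ => (A.size : ℝ)⁻¹) y :=
    fun u y => Set.indicator_nonneg (fun _ _ => by positivity) y
  rw [planted, thin_pow_apply,
    ← (Equiv.arrowProdEquivProdArrow (Fin M) (fun _ => Edge n k) (fun _ => Y)).symm.sum_comp,
    Fintype.sum_prod_type, ENNReal.ofReal_sum_of_nonneg fun s _ => Finset.sum_nonneg fun y _ =>
      mul_nonneg (Finset.prod_nonneg fun j _ => plantedWeight_nonneg A _ _ _) (hφ _),
    Finset.mul_sum]
  refine Finset.sum_congr rfl fun s _ => ?_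
  rw [ENNReal.ofReal_sum_of_nonneg fun y _ =>
      mul_nonneg (Finset.prod_nonneg fun j _ => plantedWeight_nonneg A _ _ _) (hφ _),
    Finset.mul_sum]
  refine Finset.sum_congr rfl fun y _ => ?_
  rw [ENNReal.ofReal_mul (Finset.prod_nonneg fun j _ => plantedWeight_nonneg A _ _ _), ← mul_assoc]
  congr 1
  simp only [hw, kernel_apply]
  rw [← ENNReal.ofReal_prod_of_nonneg fun j _ => hind _ _, ← ENNReal.ofReal_mul (by positivity),
    Finset.prod_mul_distrib]
  simp

/-- The distribution of the number of solutions of the random planted CSP, in terms of the thinning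
chain with a Poisson number of steps. -/
theorem plantedLaw_numSolutions (hkn : k ≤ n) (α : ℝ≥0) (E : Set ℕ) :
    (plantedLaw A α n).toMeasure {s | numSolutions A s ∈ E} =
      ∫⁻ M, ENNReal.ofReal ((2 ^ n)⁻¹ * ∑ x, (planted A (edgeTuple (n := n) (k := k)) x ^ M)
        (fun S => E.indicator 1 S.card) Finset.univ) ∂poissonMeasure (α * n) := by
  classical
  have hne : Nonempty (Edge n k) := by
    rw [← Fintype.card_pos_iff, card_edge]
    exact Nat.choose_pos hkn
  have hind : ∀ z, (0 : ℝ) ≤ E.indicator 1 z := fun z =>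
    Set.indicator_nonneg (fun _ _ => zero_le_one) z
  have hx : ∀ x : Fin n → ZMod 2, ((hypergraphLaw k α n).bind fun m =>
      (channel A.kernel m x).map fun y => (⟨x, m, y⟩ : Sample n k Y)).toOuterMeasure
        {s | numSolutions A s ∈ E} =
      ∫⁻ M, ENNReal.ofReal ((planted A (edgeTuple (n := n) (k := k)) x ^ M)
        (fun S => E.indicator 1 S.card) Finset.univ) ∂poissonMeasure (α * n) := by
    intro x
    have hch : ∀ m : Edge n k → ℕ, ((channel A.kernel m x).map fun y =>
        (⟨x, m, y⟩ : Sample n k Y)).toOuterMeasure {s | numSolutions A s ∈ E} =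
        ∑ y : Obs Y m, (∏ I, ∏ i, A.kernel (restrict x I) (y I i)) *
          ENNReal.ofReal (E.indicator 1 (numSolutions A ⟨x, m, y⟩)) := by
      intro m
      rw [PMF.toOuterMeasure_map_apply, PMF.toOuterMeasure_apply_fintype]
      refine Finset.sum_congr rfl fun y _ => ?_
      simp only [Set.indicator_apply, Set.mem_preimage, Set.mem_ofPred_eq, channel,
        PMF.ofFintype_apply]
      split_ifs <;> simp
    rw [PMF.toOuterMeasure_bind_apply]
    simp only [hch, hypergraphLaw, Measure.toPMF_apply]
    rw [tsum_pi_poisson]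
    have hrate : (Fintype.card (Edge n k) : ℝ≥0) * (α * n / (n.choose k : ℝ≥0)) = α * n := by
      have : (n.choose k : ℝ≥0) ≠ 0 := Nat.cast_ne_zero.2 (Nat.choose_pos hkn).ne'
      rw [card_edge]
      field_simp
    rw [hrate]
    refine lintegral_congr fun M => ?_
    simp only [sum_obs_counts (A := A) _ x fun z => ENNReal.ofReal (E.indicator 1 z)]
    exact sum_sequences_eq x M (E.indicator 1) hind
  have hpos : ∀ x M, 0 ≤ (planted A (edgeTuple (n := n) (k := k)) x ^ M)
      (fun S => E.indicator 1 S.card) Finset.univ := by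
    intro x M
    have h := (positive_planted A (edgeTuple (n := n) (k := k)) x).pow M
      (F := 0) (G := fun S => E.indicator 1 S.card) (fun S => hind _) Finset.univ
    rwa [map_zero] at h
  rw [PMF.toMeasure_apply_eq_toOuterMeasure, plantedLaw, PMF.toOuterMeasure_bind_apply,
    tsum_fintype]
  simp only [hx, PMF.uniformOfFintype_apply]
  rw [← Finset.mul_sum, ← lintegral_finsetSum _ fun x _ => Measurable.of_discrete,
    ← lintegral_const_mul _ Measurable.of_discrete]
  refine lintegral_congr fun M => ?_
  rw [ENNReal.ofReal_mul (by positivity), ENNReal.ofReal_sum_of_nonneg fun x _ => hpos x M]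
  congr 1
  rw [ENNReal.ofReal_inv_of_pos (by positivity), ENNReal.ofReal_pow (by norm_num)]
  simp [ZMod.card]

end model

/-! ### Concentration -/

section concentration

variable {k : ℕ} {Y : Type} [Fintype Y] {A : CSP k Y} {κ : ℝ} {ψ : Y → (Fin k → ZMod 2) → ℝ}

/-- The mean entropy of the planted CSP with exactly `⌊α n⌋` constraints. -/
def typicalLog (A : CSP k Y) (α : ℝ≥0) (n : ℕ) : ℝ :=
  meanLog A (edgeTuple (n := n) (k := k)) ⌊(α : ℝ) * n⌋₊

theorem sq_sub_floor_le {r : ℝ} (hr : 0 ≤ r) : (r - ⌊r⌋₊) ^ 2 ≤ 1 := by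
  have h1 := Nat.floor_le hr
  have h2 := Nat.lt_floor_add_one r
  rw [sq_le_one_iff_abs_le_one, abs_le]
  constructor <;> linarith

/-- The Poisson mean entropy of the model on tuples is close to the mean entropy of the model on edges
with `⌊α n⌋` constraints. -/
theorem abs_poissonMeanLog_sub_typicalLog_le (hP : A.PermInvariant) (α : ℝ≥0) {n : ℕ} (hn : 0 < n)
    (hkn : k ≤ n) :
    |poissonMeanLog A α n - typicalLog A α n| ≤ α * n * (repetitionProb k n * edgeBound A) +
      edgeBound A * ((α * n + 1) / √n + √n) := by
  have hne : Nonempty (Edge n k) := by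
    rw [← Fintype.card_pos_iff, card_edge]
    exact Nat.choose_pos hkn
  have : NeZero n := ⟨hn.ne'⟩
  have hL := edgeBound_nonneg A
  have hw : 0 < √(n : ℝ) := Real.sqrt_pos.2 (Nat.cast_pos.2 hn)
  set M₀ := ⌊(α : ℝ) * n⌋₊ with hM₀
  have hpt : ∀ M : ℕ, |meanLog A (id : (Fin k → Fin n) → _) M - typicalLog A α n| ≤
      M * (repetitionProb k n * edgeBound A) +
        edgeBound A * (((M : ℝ) - M₀) ^ 2 / √n + √n) := by
    intro M
    refine (abs_sub_le _ (meanLog A (edgeTuple (n := n) (k := k)) M) _).trans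
      (add_le_add (abs_meanLog_tuples_sub_le hP hn hkn M)
        ((abs_meanLog_sub_le A _ M M₀).trans (mul_le_mul_of_nonneg_left ?_ hL)))
    -- `|t| ≤ t² / √n + √n` turns the variance of the Poisson variable into a bound of order `√n`.
    rw [← sub_le_iff_le_add, le_div_iff₀ hw, ← sq_abs]
    nlinarith [sq_nonneg (|(M : ℝ) - M₀| - √n), abs_nonneg ((M : ℝ) - M₀)]
  have hsq := integrable_poisson_sub_sq (α * n) M₀
  have hid := integrable_poisson_id (α * n)
  have hadd : Integrable (fun M : ℕ => ((M : ℝ) - M₀) ^ 2 / √n + √n) (poissonMeasure (α * n)) :=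
    (hsq.div_const _).add (integrable_const _)
  have hint : Integrable (fun M : ℕ => (M : ℝ) * (repetitionProb k n * edgeBound A) +
      edgeBound A * (((M : ℝ) - M₀) ^ 2 / √n + √n)) (poissonMeasure (α * n)) :=
    (hid.mul_const _).add (hadd.const_mul _)
  have hval : ∫ M, ((M : ℝ) * (repetitionProb k n * edgeBound A) +
      edgeBound A * (((M : ℝ) - M₀) ^ 2 / √n + √n)) ∂poissonMeasure (α * n) =
      α * n * (repetitionProb k n * edgeBound A) +
        edgeBound A * ((α * n + (α * n - M₀) ^ 2) / √n + √n) := by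
    rw [integral_add (hid.mul_const _) (hadd.const_mul _), integral_mul_const,
      integral_const_mul, integral_add (hsq.div_const _) (integrable_const _), integral_div,
      integral_poisson_id, integral_poisson_sub_sq]
    simp
  have hmean : poissonMeanLog A α n - typicalLog A α n =
      ∫ M, (meanLog A (id : (Fin k → Fin n) → _) M - typicalLog A α n)
        ∂poissonMeasure (α * n) := by
    rw [integral_sub (integrable_meanLog _ _) (integrable_const _)]
    simp [poissonMeanLog]
  rw [hmean, ← Real.norm_eq_abs]
  refine (norm_integral_le_of_norm_le hint (.of_forall hpt)).trans ?_
  rw [hval]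
  gcongr
  exact sq_sub_floor_le (by positivity)

theorem tendsto_typicalLog_div (hψ : A.HasReplicaExpansion κ ψ) (hP : A.PermInvariant) (α : ℝ≥0) :
    ∃ C, Tendsto (fun n : ℕ => typicalLog A α n / n) atTop (𝓝 C) := by
  obtain ⟨C, hC⟩ := tendsto_poissonMeanLog_div hψ α
  refine ⟨C, ?_⟩
  have hsqrt : Tendsto (fun n : ℕ => (√(n : ℝ))⁻¹) atTop (𝓝 0) :=
    tendsto_inv_atTop_zero.comp (Real.tendsto_sqrt_atTop.comp tendsto_natCast_atTop_atTop)
  have hinv : Tendsto (fun n : ℕ => (n : ℝ)⁻¹) atTop (𝓝 0) := tendsto_inv_atTop_nhds_zero_nat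
  have herr : Tendsto (fun n : ℕ => α * (repetitionProb k n * edgeBound A) +
      edgeBound A * ((α + (n : ℝ)⁻¹) * (√(n : ℝ))⁻¹ + (√(n : ℝ))⁻¹)) atTop (𝓝 0) := by
    have := (((tendsto_repetitionProb k).mul_const (edgeBound A)).const_mul (α : ℝ)).add
      ((((hinv.const_add (α : ℝ)).mul hsqrt).add hsqrt).const_mul (edgeBound A))
    simpa using this
  have hdiff : Tendsto (fun n : ℕ => poissonMeanLog A α n / n - typicalLog A α n / n) atTop
      (𝓝 0) := by
    refine squeeze_zero_norm' ?_ herr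
    filter_upwards [eventually_gt_atTop 0, eventually_ge_atTop k] with n hn hkn
    have hn' : (0 : ℝ) < n := Nat.cast_pos.2 hn
    rw [← sub_div, Real.norm_eq_abs, abs_div, Nat.abs_cast, div_le_iff₀ hn']
    refine (abs_poissonMeanLog_sub_typicalLog_le hP α hn hkn).trans (le_of_eq ?_)
    have hs : √(n : ℝ) = n * (√(n : ℝ))⁻¹ := by
      rw [← div_eq_mul_inv, Real.div_sqrt]
    have hnn : (n : ℝ) * (n : ℝ)⁻¹ = 1 := mul_inv_cancel₀ hn'.ne'
    rw [div_eq_mul_inv]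
    linear_combination edgeBound A * hs - edgeBound A * (√(n : ℝ))⁻¹ * hnn
  simpa using hC.sub hdiff

/-- Chebyshev's inequality for `log Z`, whose variance combines the fluctuations of the labels and
edges with those of the Poisson number of constraints. -/
theorem plantedLaw_deviation_le (hT : A.TranslationInvariant) (α : ℝ≥0) {n : ℕ} (hkn : k ≤ n)
    {δ : ℝ} (hδ : 0 < δ) :
    (plantedLaw A α n).toMeasure {s | δ ≤ |Real.log (numSolutions A s) - typicalLog A α n|} ≤
      ENNReal.ofReal ((δ ^ 2)⁻¹ *
        (edgeBound A * (α * n) + edgeBound A ^ 2 * (α * n + 1))) := by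
  have hne : Nonempty (Edge n k) := by
    rw [← Fintype.card_pos_iff, card_edge]
    exact Nat.choose_pos hkn
  have hL := edgeBound_nonneg A
  set c := typicalLog A α n with hc
  set M₀ := ⌊(α : ℝ) * n⌋₊ with hM₀
  set E : Set ℕ := {z | δ ≤ |Real.log z - c|} with hE
  have hmarkov : (fun S : Finset (Fin n → ZMod 2) => E.indicator (1 : ℕ → ℝ) S.card) ≤
      (δ ^ 2)⁻¹ • fun S => (logVol S - c) ^ 2 := by
    intro S
    simp only [Pi.smul_apply, smul_eq_mul]
    by_cases h : S.card ∈ E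
    · rw [Set.indicator_of_mem h, Pi.one_apply, le_inv_mul_iff₀ (by positivity), mul_one,
        ← sq_abs (logVol S - c)]
      exact pow_le_pow_left₀ hδ.le h 2
    · rw [Set.indicator_of_notMem h]
      positivity
  have hpt : ∀ M : ℕ, (2 ^ n)⁻¹ * ∑ x, (planted A (edgeTuple (n := n) (k := k)) x ^ M)
      (fun S => E.indicator 1 S.card) Finset.univ ≤
      (δ ^ 2)⁻¹ * (edgeBound A * M + edgeBound A ^ 2 * ((M : ℝ) - M₀) ^ 2) := by
    intro M
    have h1 : ∀ x, (planted A (edgeTuple (n := n) (k := k)) x ^ M)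
        (fun S => E.indicator 1 S.card) Finset.univ ≤ (δ ^ 2)⁻¹ *
        (planted A (edgeTuple (n := n) (k := k)) x ^ M) (fun S => (logVol S - c) ^ 2)
          Finset.univ := by
      intro x
      have := (positive_planted A (edgeTuple (n := n) (k := k)) x).pow M hmarkov Finset.univ
      rwa [map_smul] at this
    have h2 := mean_sq_logVol_sub_le (edgeTuple (n := n) (k := k)) hT M c
    have h3 : (meanLog A (edgeTuple (n := n) (k := k)) M - c) ^ 2 ≤
        edgeBound A ^ 2 * ((M : ℝ) - M₀) ^ 2 := by
      rw [← mul_pow]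
      refine sq_le_sq.2 ?_
      rw [abs_mul, abs_of_nonneg hL]
      exact abs_meanLog_sub_le A _ M M₀
    calc (2 ^ n)⁻¹ * ∑ x, (planted A (edgeTuple (n := n) (k := k)) x ^ M)
          (fun S => E.indicator 1 S.card) Finset.univ
        ≤ (2 ^ n)⁻¹ * ∑ x, (δ ^ 2)⁻¹ * (planted A (edgeTuple (n := n) (k := k)) x ^ M)
          (fun S => (logVol S - c) ^ 2) Finset.univ := by
          gcongr with x
          exact h1 x
      _ = (δ ^ 2)⁻¹ * ((2 ^ n)⁻¹ * ∑ x, (planted A (edgeTuple (n := n) (k := k)) x ^ M)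
          (fun S => (logVol S - c) ^ 2) Finset.univ) := by
          rw [← Finset.mul_sum, mul_left_comm]
      _ ≤ _ := by
          gcongr
          exact h2.trans (by gcongr)
  have hsq := integrable_poisson_sub_sq (α * n) M₀
  have hid := integrable_poisson_id (α * n)
  have hint : Integrable (fun M : ℕ => (δ ^ 2)⁻¹ *
      (edgeBound A * M + edgeBound A ^ 2 * ((M : ℝ) - M₀) ^ 2)) (poissonMeasure (α * n)) :=
    ((hid.const_mul _).add (hsq.const_mul _)).const_mul _
  calc (plantedLaw A α n).toMeasure {s | δ ≤ |Real.log (numSolutions A s) - c|}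
      = _ := plantedLaw_numSolutions hkn α E
    _ ≤ ∫⁻ M, ENNReal.ofReal ((δ ^ 2)⁻¹ *
        (edgeBound A * M + edgeBound A ^ 2 * ((M : ℝ) - M₀) ^ 2)) ∂poissonMeasure (α * n) :=
        lintegral_mono fun M => ENNReal.ofReal_le_ofReal (hpt M)
    _ = ENNReal.ofReal (∫ M, (δ ^ 2)⁻¹ *
        (edgeBound A * M + edgeBound A ^ 2 * ((M : ℝ) - M₀) ^ 2) ∂poissonMeasure (α * n)) :=
        (ofReal_integral_eq_lintegral_ofReal hint (.of_forall fun M => by positivity)).symm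
    _ ≤ _ := by
        refine ENNReal.ofReal_le_ofReal ?_
        rw [integral_const_mul, integral_add (hid.const_mul _) (hsq.const_mul _),
          integral_const_mul, integral_const_mul, integral_poisson_id, integral_poisson_sub_sq]
        push_cast
        gcongr
        exact sq_sub_floor_le (by positivity)

/-- The entropy density of the random planted CSP converges in probability if the kernel is
invariant under translations and permutations, up to relabelling, and has a replica expansion. -/
theorem exists_logCountTendstoInProb (hψ : A.HasReplicaExpansion κ ψ)
    (hT : A.TranslationInvariant) (hP : A.PermInvariant) (α : ℝ≥0) :
    ∃ C, LogCountTendstoInProb A α C := by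
  obtain ⟨C, hC⟩ := tendsto_typicalLog_div hψ hP α
  have hlog : 0 < Real.log 2 := Real.log_pos one_lt_two
  refine ⟨C / Real.log 2, fun ε hε => ?_⟩
  set ε' := ε * Real.log 2 / 2 with hε'
  have hε'0 : 0 < ε' := by positivity
  have hbound : Tendsto (fun n : ℕ => ENNReal.ofReal (((ε' * n) ^ 2)⁻¹ *
      (edgeBound A * (α * n) + edgeBound A ^ 2 * (α * n + 1)))) atTop (𝓝 0) := by
    rw [← ENNReal.ofReal_zero]
    refine ENNReal.tendsto_ofReal ?_
    have hinv : Tendsto (fun n : ℕ => (n : ℝ)⁻¹) atTop (𝓝 0) := tendsto_inv_atTop_nhds_zero_nat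
    have h := ((hinv.const_mul (edgeBound A * α)).add
      ((hinv.mul (hinv.const_add (α : ℝ))).const_mul (edgeBound A ^ 2))).const_mul ((ε' ^ 2)⁻¹)
    simp only [mul_zero, zero_mul, add_zero] at h
    refine h.congr' ?_
    filter_upwards [eventually_gt_atTop 0] with n hn
    have hn' : (n : ℝ) ≠ 0 := Nat.cast_ne_zero.2 hn.ne'
    field_simp
  refine tendsto_of_tendsto_of_tendsto_of_le_of_le' tendsto_const_nhds hbound
    (.of_forall fun _ => zero_le) ?_
  filter_upwards [eventually_gt_atTop 0, eventually_ge_atTop k,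
    (Metric.tendsto_nhds.1 hC) ε' hε'0] with n hn hkn hCn
  have hn' : (0 : ℝ) < n := Nat.cast_pos.2 hn
  refine (measure_mono ?_).trans (plantedLaw_deviation_le hT α hkn (mul_pos hε'0 hn'))
  intro s hs
  rw [Set.mem_ofPred_eq] at hs ⊢
  rw [Real.dist_eq] at hCn
  have heq : Real.logb 2 (numSolutions A s) / n - C / Real.log 2 =
      (Real.log (numSolutions A s) / n - C) / Real.log 2 := by
    rw [Real.logb]
    field_simp
  rw [heq, abs_div, abs_of_pos hlog, le_div_iff₀ hlog] at hs
  have htri := abs_sub_le (Real.log (numSolutions A s) / n) (typicalLog A α n / n) C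
  rw [← sub_div, abs_div, Nat.abs_cast] at htri
  rw [← le_div_iff₀ hn']
  linarith

end concentration

/-! ### The three kernels -/

section kernels

open Classical in
/-- A sum over labels of products over replicas factorizes over the vertices of an edge. -/
theorem sum_prod_eq_shift {k l : ℕ} (U : Fin l → Fin k → ZMod 2) (τ : Fin l → ZMod 2) :
    ∑ y : Fin k → ZMod 2, ∏ j, (if U j = fun i => y i + τ j then (1 : ℝ) else 0) =
      ∏ i, ∑ z, ∏ j, if U j i = z + τ j then (1 : ℝ) else 0 := by
  rw [Fintype.prod_sum]
  refine Finset.sum_congr rfl fun y _ => ?_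
  rw [Finset.prod_comm]
  refine Finset.prod_congr rfl fun j _ => ?_
  rw [Finset.prod_boole]
  simp [funext_iff]

theorem flip_flip {k : ℕ} (u : Fin k → ZMod 2) : flip (flip u) = u := by
  ext i
  rw [flip, flip, add_assoc, show (1 + 1 : ZMod 2) = 0 by decide, add_zero]

theorem eq_flip_iff {k : ℕ} {u y : Fin k → ZMod 2} : y = flip u ↔ u = flip y :=
  ⟨fun h => by rw [h, flip_flip], fun h => by rw [h, flip_flip]⟩

theorem flip_add {k : ℕ} (u v : Fin k → ZMod 2) : flip (u + v) = flip u + v := by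
  ext i
  simp only [flip, Pi.add_apply]
  ring

theorem kSAT_hasReplicaExpansion {k : ℕ} (hk : 1 ≤ k) :
    (kSAT k hk).HasReplicaExpansion 1 fun y u => if u = flip y then 1 else 0 where
  pos := one_pos
  abs_le_one y u := by split_ifs <;> simp
  auth_eq y u := by
    by_cases h : u = flip y <;> simp [kSAT, eq_flip_iff (u := u), flip_flip, h]
  expand l := by
    refine ⟨Unit, inferInstance, fun _ => 1,
      fun _ v => ∑ z, ∏ j, if v j = z + 1 then 1 else 0, fun _ => zero_le_one,
      .inl fun _ v => Finset.sum_nonneg fun z _ => Finset.prod_nonneg fun j _ => ?_, fun U => ?_⟩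
    · split_ifs <;> simp
    · simpa [flip] using! sum_prod_eq_shift U fun _ => 1

theorem kSAT_translationInvariant {k : ℕ} (hk : 1 ≤ k) : (kSAT k hk).TranslationInvariant :=
  fun v => ⟨Equiv.addRight v, fun u y => by simp [kSAT, flip_add]⟩

theorem comp_perm_eq_iff {k : ℕ} (π : Equiv.Perm (Fin k)) (u y : Fin k → ZMod 2) :
    y ∘ π = u ∘ π ↔ y = u :=
  π.surjective.injective_comp_right.eq_iff

theorem kSAT_permInvariant {k : ℕ} (hk : 1 ≤ k) : (kSAT k hk).PermInvariant :=
  fun π => ⟨Equiv.arrowCongr π.symm (Equiv.refl _), fun u y => by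
    have h₁ : Equiv.arrowCongr π.symm (Equiv.refl _) y = y ∘ π := rfl
    have h₂ : flip (u ∘ π) = flip u ∘ π := rfl
    simp [kSAT, h₁, h₂, comp_perm_eq_iff]⟩

theorem kNAESAT_hasReplicaExpansion {k : ℕ} (hk : 2 ≤ k) :
    (kNAESAT k hk).HasReplicaExpansion 1
      fun y u => ∑ b : ZMod 2, if u = fun i => y i + b then 1 else 0 := by
  have hψ : ∀ y u : Fin k → ZMod 2, (∑ b : ZMod 2, if u = fun i => y i + b then (1 : ℝ) else 0) =
      if u = y ∨ u = flip y then 1 else 0 := by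
    intro y u
    have hne := flip_ne (by omega) y
    have h01 : (∑ b : ZMod 2, if u = fun i => y i + b then (1 : ℝ) else 0) =
        (if u = y then 1 else 0) + if u = flip y then 1 else 0 := by
      have := Fin.sum_univ_two fun b : ZMod 2 => if u = fun i => y i + b then (1 : ℝ) else 0
      refine this.trans ?_
      have h0 : (fun i => y i + (0 : ZMod 2)) = y := by simp
      congr 1
      exact if_congr (iff_of_eq (congrArg (u = ·) h0)) rfl rfl
    rw [h01]
    by_cases h1 : u = y
    · subst h1
      simp [hne]
    · simp [h1]
  refine ⟨one_pos, fun y u => ?_, fun y u => ?_, fun l => ?_⟩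
  · rw [hψ]
    split_ifs <;> simp
  · rw [hψ]
    have : y ∈ (kNAESAT k hk).auth u ↔ ¬ (u = y ∨ u = flip y) := by
      simp [kNAESAT, eq_flip_iff (u := u), eq_comm (a := u) (b := y)]
    by_cases h : u = y ∨ u = flip y <;> simp [this, h]
  · refine ⟨Fin l → ZMod 2, inferInstance, fun _ => 1,
      fun τ v => ∑ z, ∏ j, if v j = z + τ j then 1 else 0, fun _ => zero_le_one,
      .inl fun _ v => Finset.sum_nonneg fun z _ => Finset.prod_nonneg fun j _ => ?_, fun U => ?_⟩
    · split_ifs <;> simp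
    · simp only [Fintype.prod_sum, one_mul]
      rw [Finset.sum_comm]
      refine Finset.sum_congr rfl fun τ _ => ?_
      rw [← Fintype.prod_sum fun (i : Fin k) (z : ZMod 2) =>
        ∏ j, if U j i = z + τ j then (1 : ℝ) else 0]
      convert! sum_prod_eq_shift U τ

theorem kNAESAT_translationInvariant {k : ℕ} (hk : 2 ≤ k) : (kNAESAT k hk).TranslationInvariant :=
  fun v => ⟨Equiv.addRight v, fun u y => by simp [kNAESAT, flip_add]⟩

theorem kNAESAT_permInvariant {k : ℕ} (hk : 2 ≤ k) : (kNAESAT k hk).PermInvariant :=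
  fun π => ⟨Equiv.arrowCongr π.symm (Equiv.refl _), fun u y => by
    have h₁ : Equiv.arrowCongr π.symm (Equiv.refl _) y = y ∘ π := rfl
    have h₂ : flip (u ∘ π) = flip u ∘ π := rfl
    simp [kNAESAT, h₁, h₂, comp_perm_eq_iff]⟩

/-- The nontrivial character of `ℤ/2`, with values in the real numbers. -/
def signChar (a : ZMod 2) : ℝ := if a = 0 then 1 else -1

theorem signChar_add (a b : ZMod 2) : signChar (a + b) = signChar a * signChar b := by
  have h : ∀ c : ZMod 2, c = 0 ∨ c = 1 := by decide
  rcases h a with rfl | rfl <;> rcases h b with rfl | rfl <;>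
    simp [signChar, show (1 + 1 : ZMod 2) = 0 by decide]

theorem signChar_sum {ι : Type*} (s : Finset ι) (u : ι → ZMod 2) :
    signChar (∑ i ∈ s, u i) = ∏ i ∈ s, signChar (u i) := by
  classical
  induction s using Finset.induction_on with
  | empty => simp [signChar]
  | insert i s hi ih => rw [Finset.sum_insert hi, Finset.prod_insert hi, signChar_add, ih]

theorem kXORSAT_hasReplicaExpansion {k : ℕ} (hk : Even k) :
    (kXORSAT k).HasReplicaExpansion 2⁻¹ fun y u => -signChar (y + ∑ i, u i) where
  pos := by norm_num
  abs_le_one y u := by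
    rw [signChar]
    split_ifs <;> simp
  auth_eq y u := by
    have : y ∈ (kXORSAT k).auth u ↔ y + ∑ i, u i = 0 := by
      rw [add_eq_zero_iff_eq_neg, ZMod.neg_eq_self_mod_two]
      simp [kXORSAT]
    by_cases h : y + ∑ i, u i = 0
    · rw [Set.indicator_of_mem (Finset.mem_coe.2 (this.2 h)), h]
      norm_num [signChar]
    · rw [Set.indicator_of_notMem (mt (fun h => this.1 (Finset.mem_coe.1 h)) h), signChar,
        if_neg h]
      norm_num
  expand l := by
    refine ⟨Unit, inferInstance, fun _ => ∑ y, (-signChar y) ^ l, fun _ v => ∏ j, signChar (v j),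
      fun _ => ?_, .inr hk, fun U => ?_⟩
    · have : ∑ y, (-signChar y) ^ l = (-1) ^ l + 1 := by
        refine (Fin.sum_univ_two fun y : ZMod 2 => (-signChar y) ^ l).trans ?_
        change (-signChar 0) ^ l + (-signChar 1) ^ l = _
        simp [signChar]
      rw [this]
      rcases neg_one_pow_eq_or ℝ l with h | h <;> rw [h] <;> norm_num
    · simp only [Finset.univ_unique, Finset.sum_singleton, Finset.sum_mul]
      refine Finset.sum_congr rfl fun y _ => ?_
      simp only [signChar_add, signChar_sum, ← neg_mul]
      rw [Finset.prod_mul_distrib, Finset.prod_const, Finset.card_univ, Fintype.card_fin,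
        Finset.prod_comm]

theorem kXORSAT_translationInvariant (k : ℕ) : (kXORSAT k).TranslationInvariant :=
  fun v => ⟨Equiv.addRight (∑ i, v i), fun u y => by simp [kXORSAT, Finset.sum_add_distrib]⟩

theorem kXORSAT_permInvariant (k : ℕ) : (kXORSAT k).PermInvariant :=
  fun π => ⟨Equiv.refl _, fun u y => by simp [kXORSAT, Equiv.sum_comp π u]⟩

end kernels

end PlantedCSP

end

theorem mainTheorem4 (α : ℝ≥0) (hα : 0 < α) :
    (∀ (k : ℕ) (hk : 1 ≤ k), ∃ C : ℝ,
      PlantedCSP.LogCountTendstoInProb (PlantedCSP.kSAT k hk) α C) ∧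
    (∀ (k : ℕ) (hk : 2 ≤ k), ∃ C : ℝ,
      PlantedCSP.LogCountTendstoInProb (PlantedCSP.kNAESAT k hk) α C) ∧
    (∀ k : ℕ, 1 ≤ k → Even k → ∃ C : ℝ,
      PlantedCSP.LogCountTendstoInProb (PlantedCSP.kXORSAT k) α C) :=
  ⟨fun _ hk => PlantedCSP.exists_logCountTendstoInProb (PlantedCSP.kSAT_hasReplicaExpansion hk)
      (PlantedCSP.kSAT_translationInvariant hk) (PlantedCSP.kSAT_permInvariant hk) α,
    fun _ hk => PlantedCSP.exists_logCountTendstoInProb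
      (PlantedCSP.kNAESAT_hasReplicaExpansion hk) (PlantedCSP.kNAESAT_translationInvariant hk)
      (PlantedCSP.kNAESAT_permInvariant hk) α,
    fun k _ hk => PlantedCSP.exists_logCountTendstoInProb
      (PlantedCSP.kXORSAT_hasReplicaExpansion hk) (PlantedCSP.kXORSAT_translationInvariant k)
      (PlantedCSP.kXORSAT_permInvariant k) α⟩
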